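/- Let $n\ge 3$ and $k\ge 2$ be integers, let $R\in\mathbb R$, and put $H_2=\dfrac{R-n(n-1)}{n(n-1)}$. Suppose that $H_2$ lies strictly between the two numbers $\cot^2(\pi/k)=\dfrac{1}{(\tan(\pi/k))^2}$ (which is $0$ for $k=2$) and $\dfrac{k^2-2}{n}$, that is, $\min\{\cot^2\tfrac{\pi}{k},\tfrac{k^2-2}{n}\}<H_2<\max\{\cot^2\tfrac{\pi}{k},\tfrac{k^2-2}{n}\}$. Then $H_2>0$, equivalently $R>n(n-1)$, and there exists a compact, connected, smooth, embedded $n$-dimensional hypersurface $M$ of the unit sphere $S^{n+1}(1)\subset\mathbb R^{n+2}$ such that 1. the second mean curvature $\binom n2^{-1}\sum_{1\le i<j\le n}\lambda_i\lambda_j$ of $M$ (where $\lambda_1,\dots,\lambda_n$ are the principal curvatures of $M$ in $S^{n+1}(1)$) is constant, equal to $H_2$; 2. the scalar curvature (the sum $\sum_{i\ne j}R_{ijij}$ over an orthonormal frame) of the induced Riemannian metric of $M$ is constant, equal to $R$; 3. $M$ is nontrivial: as a Riemannian manifold it is isometric neither to a standard round $n$-sphere $\{x\in S^{n+1}(1):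 x_{n+2}=c\}$, $-1<c<1$, nor to a Clifford hypersurface $S^{l}(a)\times S^{n-l}(b)$, $1\le l\le n-1$, $a,b>0$, $a^2+b^2=1$. -/

import Mathlib

open scoped ContDiff

noncomputable section

namespace SphereHypersurface

/-- The Euclidean space `ℝ^N`. -/
abbrev E (N : ℕ) : Type := EuclideanSpace ℝ (Fin N)

/-- The partial derivative `∂F/∂u_i` at `u`. -/
def pderiv {d : ℕ} {G : Type} [NormedAddCommGroup G] [NormedSpace ℝ G]
    (i : Fin d) (F : E d → G) (u : E d) : G :=
  fderiv ℝ F u (EuclideanSpace.single i (1 : ℝ))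

/-! ### Embedded submanifolds of Euclidean space -/

/-- `f`, restricted to the open set `U ⊆ ℝ^d`, is a smooth local parametrization of `M ⊆ ℝ^N`:
a smooth immersion which is a homeomorphism of `U` onto a relatively open subset of `M`.
(The values of `f` outside `U` play no role.) -/
structure IsLocalParam {d N : ℕ} (M : Set (E N)) (U : Set (E d)) (f : E d → E N) : Prop where
  isOpen_source : IsOpen U
  contDiffOn : ContDiffOn ℝ ∞ f U
  immersion : ∀ u ∈ U, Function.Injective (fderiv ℝ f u)
  isEmbedding : Topology.IsEmbedding (U.domRestrict f)
  image_open : ∃ V : Set (E N), IsOpen V ∧ f '' U = M ∩ V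

/-- `M ⊆ ℝ^N` is a smooth embedded submanifold of dimension `d`. -/
def IsEmbeddedSubmanifold (d : ℕ) {N : ℕ} (M : Set (E N)) : Prop :=
  ∀ p ∈ M, ∃ (U : Set (E d)) (f : E d → E N), IsLocalParam M U f ∧ p ∈ f '' U

/-- A compact, connected, embedded `n`-dimensional smooth hypersurface of the unit sphere
`S^{n+1}(1) ⊆ ℝ^{n+2}`. -/
structure IsCompactEmbeddedHypersurface (n : ℕ) (M : Set (E (n + 2))) : Prop where
  subset_sphere : M ⊆ Metric.sphere (0 : E (n + 2)) 1
  submanifold : IsEmbeddedSubmanifold n M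
  compact : IsCompact M
  connected : IsConnected M

/-! ### Intrinsic geometry -/

/-- The induced Riemannian metric (first fundamental form) `g_ij = ⟨∂_i f, ∂_j f⟩` in the
parametrization `f`. -/
def metric {d N : ℕ} (f : E d → E N) (u : E d) : Matrix (Fin d) (Fin d) ℝ :=
  Matrix.of fun i j => inner ℝ (pderiv i f u) (pderiv j f u)

/-- The Christoffel symbols `Γ^l_ij = ½ ∑_m g^{lm} (∂_i g_mj + ∂_j g_mi - ∂_m g_ij)` of a metric
`g` on a domain of `ℝ^d`. -/
def christoffel {d : ℕ} (g : E d → Matrix (Fin d) (Fin d) ℝ) (l i j : Fin d) (u : E d) : ℝ :=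
  (1 / 2 : ℝ) * ∑ m : Fin d, (g u)⁻¹ l m *
    (pderiv i (fun v => g v m j) u + pderiv j (fun v => g v m i) u
      - pderiv m (fun v => g v i j) u)

/-- The Riemann curvature tensor
`R^l_{kij} = ∂_i Γ^l_jk - ∂_j Γ^l_ik + ∑_m (Γ^l_im Γ^m_jk - Γ^l_jm Γ^m_ik)`, the `∂_l`-component of
`R(∂_i, ∂_j) ∂_k`. -/
def riemann {d : ℕ} (g : E d → Matrix (Fin d) (Fin d) ℝ) (l k i j : Fin d) (u : E d) : ℝ :=
  pderiv i (christoffel g l j k) u - pderiv j (christoffel g l i k) u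
    + ∑ m : Fin d, (christoffel g l i m u * christoffel g m j k u
        - christoffel g l j m u * christoffel g m i k u)

/-- The Ricci tensor `Ric_kj = ∑_l R^l_{klj}`. -/
def ricci {d : ℕ} (g : E d → Matrix (Fin d) (Fin d) ℝ) (k j : Fin d) (u : E d) : ℝ :=
  ∑ l : Fin d, riemann g l k l j u

/-- The scalar curvature `∑ g^{kj} Ric_kj`; the unit sphere of dimension `d` has `d (d - 1)`. -/
def scalarCurvature {d : ℕ} (g : E d → Matrix (Fin d) (Fin d) ℝ) (u : E d) : ℝ :=
  ∑ k : Fin d, ∑ j : Fin d, (g u)⁻¹ k j * ricci g k j u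

/-- The scalar curvature of the `d`-dimensional submanifold `M` (with the induced Riemannian
metric) is constant, equal to `R`. -/
def HasConstantScalarCurvature (d : ℕ) {N : ℕ} (M : Set (E N)) (R : ℝ) : Prop :=
  ∀ (U : Set (E d)) (f : E d → E N), IsLocalParam M U f →
    ∀ u ∈ U, scalarCurvature (metric f) u = R

/-! ### Extrinsic geometry of hypersurfaces of the sphere -/

/-- `ν` is a unit normal, at the point `f u`, of the hypersurface of the unit sphere parametrized
by `f`: it is tangent to the sphere and orthogonal to the hypersurface. -/
structure IsUnitNormal {n N : ℕ} (f : E n → E N) (u : E n) (ν : E N) : Prop where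
  norm_eq_one : ‖ν‖ = 1
  tangent_sphere : inner ℝ (f u) ν = 0
  normal : ∀ i : Fin n, inner ℝ (pderiv i f u) ν = 0

/-- The second fundamental form `h_ij = ⟨∂_i ∂_j f, ν⟩` with respect to the unit normal `ν`. -/
def secondForm {n N : ℕ} (f : E n → E N) (ν : E N) (u : E n) : Matrix (Fin n) (Fin n) ℝ :=
  Matrix.of fun i j => inner ℝ (pderiv i (pderiv j f) u) ν

/-- The principal curvatures: the eigenvalues, with multiplicity, of the shape operator
`g⁻¹ h`. -/
def principalCurvatures {n N : ℕ} (f : E n → E N) (ν : E N) (u : E n) : Multiset ℝ :=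
  ((metric f u)⁻¹ * secondForm f ν u).charpoly.roots

/-- The `m`-th mean curvature `H_m`, given by `C(n,m) H_m = ∑_{i₁<⋯<i_m} λ_{i₁} ⋯ λ_{i_m}`. -/
def mthMeanCurvature {n N : ℕ} (m : ℕ) (f : E n → E N) (ν : E N) (u : E n) : ℝ :=
  (principalCurvatures f ν u).esymm m / (n.choose m : ℝ)

/-- The second mean curvature `H_2` of the hypersurface `M` of `S^{n+1}(1)` is constant, equal to
`c`. (The choice between the two unit normals `±ν` does not affect `H_2`.) -/
def HasConstantSecondMeanCurvature (n : ℕ) (M : Set (E (n + 2))) (c : ℝ) : Prop :=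
  ∀ (U : Set (E n)) (f : E n → E (n + 2)), IsLocalParam M U f →
    ∀ u ∈ U, ∀ ν : E (n + 2), IsUnitNormal f u ν → mthMeanCurvature 2 f ν u = c

/-! ### Isometries, round spheres, Clifford hypersurfaces -/

/-- The `d`-dimensional submanifolds `M` and `M'` are isometric as Riemannian manifolds: there is
a bijection `φ : M → M'` that carries every local parametrization of `M` to a local
parametrization of `M'` (so `φ` is a diffeomorphism) with the same first fundamental form. -/
def AreIsometric (d : ℕ) {N N' : ℕ} (M : Set (E N)) (M' : Set (E N')) : Prop :=
  ∃ φ : E N → E N', Set.BijOn φ M M' ∧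
    ∀ (U : Set (E d)) (f : E d → E N), IsLocalParam M U f →
      IsLocalParam M' U (φ ∘ f) ∧ ∀ u ∈ U, metric (φ ∘ f) u = metric f u

/-- The standard round `n`-sphere of radius `√(1 - c²)` in `S^{n+1}(1)`, for `-1 < c < 1`. -/
def roundSphere (n : ℕ) (c : ℝ) : Set (E (n + 2)) :=
  {x | x ∈ Metric.sphere (0 : E (n + 2)) 1 ∧ x (Fin.last (n + 1)) = c}

/-- The Clifford hypersurface `S^l(a) × S^{n-l}(b) ⊆ ℝ^{l+1} × ℝ^{n-l+1} = ℝ^{n+2}`, contained in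
`S^{n+1}(1)` when `a² + b² = 1`. -/
def cliffordHypersurface (n l : ℕ) (a b : ℝ) : Set (E (n + 2)) :=
  {x | (∑ i : Fin (n + 2), if i.val ≤ l then x i ^ 2 else 0) = a ^ 2 ∧
       (∑ i : Fin (n + 2), if i.val ≤ l then 0 else x i ^ 2) = b ^ 2}

/-- `M` is nontrivial: it is isometric neither to a standard round sphere nor to a Clifford
hypersurface of `S^{n+1}(1)`. -/
def IsNontrivial (n : ℕ) (M : Set (E (n + 2))) : Prop :=
  (∀ c : ℝ, -1 < c → c < 1 → ¬ AreIsometric n M (roundSphere n c)) ∧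
  (∀ (l : ℕ) (a b : ℝ), 1 ≤ l → l ≤ n - 1 → 0 < a → 0 < b → a ^ 2 + b ^ 2 = 1 →
    ¬ AreIsometric n M (cliffordHypersurface n l a b))

end SphereHypersurface

end

namespace SphereHypersurface

open scoped InnerProductSpace Matrix

/-! ### Partial derivatives -/

section PartialDerivatives

variable {d : ℕ} {G : Type} [NormedAddCommGroup G]

lemma contDiffOn_pderiv [NormedSpace ℝ G] {U : Set (E d)} (hU : IsOpen U) {F : E d → G}
    (hF : ContDiffOn ℝ ∞ F U) (i : Fin d) : ContDiffOn ℝ ∞ (pderiv i F) U :=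
  (hF.fderiv_of_isOpen hU (by simp)).clm_apply contDiffOn_const

lemma differentiableAt_of_contDiffOn [NormedSpace ℝ G] {U : Set (E d)} (hU : IsOpen U)
    {F : E d → G} (hF : ContDiffOn ℝ ∞ F U) {u : E d} (hu : u ∈ U) : DifferentiableAt ℝ F u :=
  (hF.contDiffAt (hU.mem_nhds hu)).differentiableAt (by simp)

lemma pderiv_congr_of_eqOn [NormedSpace ℝ G] {U : Set (E d)} (hU : IsOpen U) {F F' : E d → G}
    (h : Set.EqOn F F' U) (i : Fin d) : Set.EqOn (pderiv i F) (pderiv i F') U := by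
  intro u hu
  unfold pderiv
  rw [(h.eventuallyEq_of_mem (hU.mem_nhds hu)).fderiv_eq]

lemma pderiv_comm [NormedSpace ℝ G] {U : Set (E d)} (hU : IsOpen U) {F : E d → G}
    (hF : ContDiffOn ℝ ∞ F U) (i j : Fin d) :
    Set.EqOn (pderiv i (pderiv j F)) (pderiv j (pderiv i F)) U := by
  intro u hu
  have h2 : ContDiffAt ℝ ∞ F u := hF.contDiffAt (hU.mem_nhds hu)
  have hsymm : IsSymmSndFDerivAt ℝ F u := h2.isSymmSndFDerivAt
    (by rw [minSmoothness_of_isRCLikeNormedField]; exact WithTop.coe_le_coe.2 (le_top : (2 : ℕ∞) ≤ ⊤))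
  have hd : DifferentiableAt ℝ (fderiv ℝ F) u :=
    ((hF.fderiv_of_isOpen hU (m := ∞) (by simp)).contDiffAt
      (hU.mem_nhds hu)).differentiableAt (by simp)
  have key : ∀ i j : Fin d, pderiv i (pderiv j F) u =
      fderiv ℝ (fderiv ℝ F) u (EuclideanSpace.single i 1) (EuclideanSpace.single j 1) := by
    intro i j
    change fderiv ℝ (fun v => fderiv ℝ F v (EuclideanSpace.single j (1 : ℝ))) u _ = _
    rw [fderiv_clm_apply hd (differentiableAt_const _)]
    simp
  rw [key, key, hsymm.eq]

lemma pderiv_inner [InnerProductSpace ℝ G] {F F' : E d → G} {u : E d}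
    (hF : DifferentiableAt ℝ F u) (hF' : DifferentiableAt ℝ F' u) (i : Fin d) :
    pderiv i (fun v => ⟪F v, F' v⟫_ℝ) u = ⟪pderiv i F u, F' u⟫_ℝ + ⟪F u, pderiv i F' u⟫_ℝ := by
  unfold pderiv
  rw [fderiv_inner_apply ℝ hF hF', add_comm]

lemma pderiv_eq_zero_of_const [NormedSpace ℝ G] {U : Set (E d)} (hU : IsOpen U) {F : E d → G}
    {c : G} (h : ∀ u ∈ U, F u = c) (i : Fin d) {u : E d} (hu : u ∈ U) : pderiv i F u = 0 := by
  rw [pderiv_congr_of_eqOn hU (F' := fun _ => c) h i hu]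
  simp [pderiv]

lemma pderiv_mul {a b : E d → ℝ} {u : E d} (ha : DifferentiableAt ℝ a u)
    (hb : DifferentiableAt ℝ b u) (i : Fin d) :
    pderiv i (fun v => a v * b v) u = pderiv i a u * b u + a u * pderiv i b u := by
  unfold pderiv
  rw [fderiv_fun_mul ha hb]
  simp
  ring

lemma pderiv_sum {ι : Type} (s : Finset ι) {a : ι → E d → ℝ} {u : E d}
    (ha : ∀ l ∈ s, DifferentiableAt ℝ (a l) u) (i : Fin d) :
    pderiv i (fun v => ∑ l ∈ s, a l v) u = ∑ l ∈ s, pderiv i (a l) u := by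
  unfold pderiv
  rw [fderiv_fun_sum ha]
  simp

end PartialDerivatives

/-! ### Differentiability of the inverse of a matrix-valued function -/

section MatrixCalculus

variable {X : Type} [NormedAddCommGroup X] [NormedSpace ℝ X] {d : ℕ}

lemma differentiableAt_det {A : X → Matrix (Fin d) (Fin d) ℝ} {x : X}
    (hA : ∀ i j, DifferentiableAt ℝ (fun y => A y i j) x) :
    DifferentiableAt ℝ (fun y => (A y).det) x := by
  simp only [Matrix.det_apply]
  refine DifferentiableAt.fun_sum fun σ _ => DifferentiableAt.const_smul ?_ _
  exact (HasFDerivAt.finsetProd (g := fun i y => A y (σ i) i)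
    fun i _ => (hA (σ i) i).hasFDerivAt).differentiableAt

lemma differentiableAt_matrix_inv {A : X → Matrix (Fin d) (Fin d) ℝ} {x : X}
    (hA : ∀ i j, DifferentiableAt ℝ (fun y => A y i j) x) (hdet : (A x).det ≠ 0) (i j : Fin d) :
    DifferentiableAt ℝ (fun y => (A y)⁻¹ i j) x := by
  simp only [Matrix.inv_def, Matrix.smul_apply, smul_eq_mul, Ring.inverse_eq_inv',
    Matrix.adjugate_apply]
  refine DifferentiableAt.fun_mul ((differentiableAt_det hA).fun_inv hdet) (differentiableAt_det ?_)
  intro k l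
  simp only [Matrix.updateRow_apply]
  split_ifs
  · exact differentiableAt_const _
  · exact hA k l

end MatrixCalculus

/-! ### The Gram matrix of an immersion and the adapted frame -/

lemma linearIndependent_pderiv {d N : ℕ} {f : E d → E N} {u : E d}
    (h : Function.Injective (fderiv ℝ f u)) :
    LinearIndependent ℝ (fun i => pderiv i f u) := by
  have hb := (EuclideanSpace.basisFun (Fin d) ℝ).toBasis.linearIndependent
  have := hb.map' (fderiv ℝ f u : E d →ₗ[ℝ] E N) (LinearMap.ker_eq_bot.2 h)
  have h2 : (fun i => pderiv i f u) =
      (fderiv ℝ f u : E d →ₗ[ℝ] E N) ∘ (EuclideanSpace.basisFun (Fin d) ℝ).toBasis := by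
    ext i
    simp [pderiv]
  exact h2 ▸ this

lemma metric_det_ne_zero {d N : ℕ} {f : E d → E N} {u : E d}
    (h : Function.Injective (fderiv ℝ f u)) : (metric f u).det ≠ 0 :=
  (Matrix.posDef_gram_of_linearIndependent (𝕜 := ℝ) (linearIndependent_pderiv h)).det_pos.ne'

lemma metric_transpose {d N : ℕ} (f : E d → E N) (u : E d) : (metric f u)ᵀ = metric f u := by
  ext i j
  simp [metric, real_inner_comm]

lemma metric_inv_transpose {d N : ℕ} (f : E d → E N) (u : E d) :
    ((metric f u)⁻¹)ᵀ = (metric f u)⁻¹ := by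
  rw [Matrix.transpose_nonsing_inv, metric_transpose]

lemma metric_inv_symm {d N : ℕ} (f : E d → E N) (u : E d) (l m : Fin d) :
    (metric f u)⁻¹ l m = (metric f u)⁻¹ m l :=
  congrFun (congrFun (metric_inv_transpose f u) m) l

/-- The tangent frame `∂_i f`, the position vector and the unit normal of a hypersurface of the
sphere resolve the inner product of the ambient space. -/
lemma inner_eq_frame {n : ℕ} {f : E n → E (n + 2)} {u : E n}
    (himm : Function.Injective (fderiv ℝ f u)) (hs : ‖f u‖ = 1)
    (hs' : ∀ i, ⟪f u, pderiv i f u⟫_ℝ = 0) {ν : E (n + 2)} (hν : IsUnitNormal f u ν)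
    (a b : E (n + 2)) :
    ⟪a, b⟫_ℝ = ∑ l, ∑ m, (metric f u)⁻¹ l m * ⟪a, pderiv l f u⟫_ℝ * ⟪b, pderiv m f u⟫_ℝ
      + ⟪a, f u⟫_ℝ * ⟪b, f u⟫_ℝ + ⟪a, ν⟫_ℝ * ⟪b, ν⟫_ℝ := by
  set p := f u
  set J : Fin n → E (n + 2) := fun i => pderiv i f u with hJ
  have hpp : ⟪p, p⟫_ℝ = 1 := by rw [real_inner_self_eq_norm_sq, hs, one_pow]
  have hνν : ⟪ν, ν⟫_ℝ = 1 := by rw [real_inner_self_eq_norm_sq, hν.norm_eq_one, one_pow]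
  have hpν : ⟪p, ν⟫_ℝ = 0 := hν.tangent_sphere
  have hνJ : ∀ i, ⟪ν, J i⟫_ℝ = 0 := fun i => by rw [real_inner_comm]; exact hν.normal i
  have hmem : ∀ {S : Set (E (n + 2))} {x : E (n + 2)}, ⟪x, x⟫_ℝ = 1 → (∀ y ∈ S, ⟪x, y⟫_ℝ = 0) →
      x ∉ Submodule.span ℝ S := by
    intro S x hx hS hxS
    have : ∀ y ∈ Submodule.span ℝ S, ⟪x, y⟫_ℝ = 0 := fun y hy => by
      induction hy using Submodule.span_induction with
      | mem y hy => exact hS y hy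
      | zero => simp
      | add y z _ _ h1 h2 => rw [inner_add_right, h1, h2, add_zero]
      | smul c y _ h1 => rw [inner_smul_right, h1, mul_zero]
    rw [this x hxS] at hx
    exact zero_ne_one hx
  have hli : LinearIndependent ℝ (Fin.cons p (Fin.cons ν J : Fin (n + 1) → E (n + 2)) :
      Fin (n + 2) → E (n + 2)) := by
    refine linearIndependent_finCons.2 ⟨linearIndependent_finCons.2
      ⟨linearIndependent_pderiv himm, hmem hνν ?_⟩, hmem hpp ?_⟩
    · rintro _ ⟨i, rfl⟩
      exact hνJ i
    · rintro _ ⟨i, rfl⟩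
      refine Fin.cases ?_ (fun i => ?_) i
      · simpa using hpν
      · simpa using hs' i
  have htop := hli.span_eq_top_of_card_eq_finrank (by simp)
  set b' : E (n + 2) := b - (∑ l, (∑ m, (metric f u)⁻¹ l m * ⟪b, J m⟫_ℝ) • J l)
    - ⟪b, p⟫_ℝ • p - ⟪b, ν⟫_ℝ • ν with hb'
  have hgg := Matrix.mul_nonsing_inv (metric f u)
    (isUnit_iff_ne_zero.2 (metric_det_ne_zero himm))
  have hb0 : ∀ x : E (n + 2), ⟪x, b'⟫_ℝ = 0 := by
    intro x
    have hx : x ∈ Submodule.span ℝ (Set.range (Fin.cons p (Fin.cons ν J : Fin (n + 1) → E (n + 2)) :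
      Fin (n + 2) → E (n + 2))) := htop ▸ Submodule.mem_top
    induction hx using Submodule.span_induction with
    | zero => simp
    | add y z _ _ h1 h2 => rw [inner_add_left, h1, h2, add_zero]
    | smul c y _ h1 => rw [inner_smul_left, h1, mul_zero]
    | mem y hy =>
      obtain ⟨i, rfl⟩ := hy
      refine Fin.cases ?_ (fun i => Fin.cases ?_ (fun k => ?_) i) i
      · simp only [Fin.cons_zero, hb', inner_sub_right, inner_sum, inner_smul_right, hpp, hpν,
          real_inner_comm p b]
        simp [hJ, hs']
      · simp only [Fin.cons_zero, Fin.cons_succ, hb', inner_sub_right, inner_sum, inner_smul_right,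
          hνν, hνJ, real_inner_comm ν b, real_inner_comm p ν ▸ hpν]
        simp
      · have hJp : ⟪J k, p⟫_ℝ = 0 := by rw [real_inner_comm]; exact hs' k
        have hJν : ⟪J k, ν⟫_ℝ = 0 := hν.normal k
        simp only [Fin.cons_succ, hb', inner_sub_right, inner_sum, inner_smul_right, hJp, hJν,
          mul_zero, sub_zero]
        have h1 : ∑ l, (∑ m, (metric f u)⁻¹ l m * ⟪b, J m⟫_ℝ) * ⟪J k, J l⟫_ℝ
            = ((metric f u * (metric f u)⁻¹).mulVec fun m => ⟪b, J m⟫_ℝ) k := by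
          rw [← Matrix.mulVec_mulVec]
          simp [Matrix.mulVec, dotProduct, metric, hJ, mul_comm]
        rw [h1, hgg, Matrix.one_mulVec, real_inner_comm, sub_self]
  have hab := hb0 a
  simp only [hb', inner_sub_right, inner_sum, inner_smul_right] at hab
  have h2 : ∑ l, ∑ m, (metric f u)⁻¹ l m * ⟪a, J l⟫_ℝ * ⟪b, J m⟫_ℝ
      = ∑ l, (∑ m, (metric f u)⁻¹ l m * ⟪b, J m⟫_ℝ) * ⟪a, J l⟫_ℝ := by
    refine Finset.sum_congr rfl fun l _ => ?_
    rw [Finset.sum_mul]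
    exact Finset.sum_congr rfl fun m _ => by ring
  rw [h2]
  linarith

/-! ### Christoffel symbols and the Gauss equation -/

section Christoffel

variable {d N : ℕ} {U : Set (E d)} {f : E d → E N}

lemma pderiv_metric (hU : IsOpen U) (hf : ContDiffOn ℝ ∞ f U) {u : E d} (hu : u ∈ U)
    (k i j : Fin d) :
    pderiv k (fun v => metric f v i j) u =
      ⟪pderiv k (pderiv i f) u, pderiv j f u⟫_ℝ + ⟪pderiv i f u, pderiv k (pderiv j f) u⟫_ℝ :=
  pderiv_inner (differentiableAt_of_contDiffOn hU (contDiffOn_pderiv hU hf i) hu)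
    (differentiableAt_of_contDiffOn hU (contDiffOn_pderiv hU hf j) hu) k

lemma differentiableAt_metric (hU : IsOpen U) (hf : ContDiffOn ℝ ∞ f U) {u : E d} (hu : u ∈ U)
    (i j : Fin d) : DifferentiableAt ℝ (fun v => metric f v i j) u :=
  (differentiableAt_of_contDiffOn hU (contDiffOn_pderiv hU hf i) hu).inner ℝ
    (differentiableAt_of_contDiffOn hU (contDiffOn_pderiv hU hf j) hu)

lemma christoffel_metric (hU : IsOpen U) (hf : ContDiffOn ℝ ∞ f U) {u : E d} (hu : u ∈ U)
    (l i j : Fin d) :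
    christoffel (metric f) l i j u =
      ∑ m, (metric f u)⁻¹ l m * ⟪pderiv i (pderiv j f) u, pderiv m f u⟫_ℝ := by
  unfold christoffel
  rw [Finset.mul_sum]
  refine Finset.sum_congr rfl fun m _ => ?_
  rw [pderiv_metric hU hf hu, pderiv_metric hU hf hu, pderiv_metric hU hf hu,
    pderiv_comm hU hf m j hu, pderiv_comm hU hf m i hu, pderiv_comm hU hf j i hu,
    real_inner_comm _ (pderiv m f u), real_inner_comm (pderiv j (pderiv m f) u) (pderiv i f u)]
  ring

lemma sum_metric_mul_christoffel (hU : IsOpen U) (hf : ContDiffOn ℝ ∞ f U) {u : E d} (hu : u ∈ U)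
    (himm : Function.Injective (fderiv ℝ f u)) (m i j : Fin d) :
    ∑ l, metric f u m l * christoffel (metric f) l i j u =
      ⟪pderiv i (pderiv j f) u, pderiv m f u⟫_ℝ := by
  simp only [christoffel_metric hU hf hu]
  have h := congrFun (congrArg (fun A : Matrix (Fin d) (Fin d) ℝ =>
    A *ᵥ fun q => ⟪pderiv i (pderiv j f) u, pderiv q f u⟫_ℝ)
      (Matrix.mul_nonsing_inv (metric f u) (isUnit_iff_ne_zero.2 (metric_det_ne_zero himm)))) m
  simp only [← Matrix.mulVec_mulVec, Matrix.one_mulVec] at h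
  exact h

lemma differentiableAt_christoffel (hU : IsOpen U) (hf : ContDiffOn ℝ ∞ f U)
    {u : E d} (hu : u ∈ U) (himm : Function.Injective (fderiv ℝ f u)) (l i j : Fin d) :
    DifferentiableAt ℝ (christoffel (metric f) l i j) u := by
  have h : christoffel (metric f) l i j =ᶠ[nhds u] fun v =>
      ∑ m, (metric f v)⁻¹ l m * ⟪pderiv i (pderiv j f) v, pderiv m f v⟫_ℝ :=
    Filter.eventuallyEq_of_mem (hU.mem_nhds hu) fun v hv => christoffel_metric hU hf hv l i j
  refine DifferentiableAt.congr_of_eventuallyEq ?_ h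
  refine DifferentiableAt.fun_sum fun m _ => DifferentiableAt.fun_mul
    (differentiableAt_matrix_inv (differentiableAt_metric hU hf hu) (metric_det_ne_zero himm) l m) ?_
  exact (differentiableAt_of_contDiffOn hU
    (contDiffOn_pderiv hU (contDiffOn_pderiv hU hf j) i) hu).inner ℝ
    (differentiableAt_of_contDiffOn hU (contDiffOn_pderiv hU hf m) hu)

end Christoffel

section Gauss

variable {n : ℕ} {U : Set (E n)} {f : E n → E (n + 2)}

lemma inner_pderiv_self (hU : IsOpen U) (hf : ContDiffOn ℝ ∞ f U) (hs : ∀ u ∈ U, ‖f u‖ = 1)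
    {u : E n} (hu : u ∈ U) (i : Fin n) : ⟪f u, pderiv i f u⟫_ℝ = 0 := by
  have h1 := pderiv_inner (differentiableAt_of_contDiffOn hU hf hu)
    (differentiableAt_of_contDiffOn hU hf hu) i
  rw [pderiv_eq_zero_of_const hU (c := 1)
    (fun v hv => by rw [real_inner_self_eq_norm_sq, hs v hv, one_pow]) i hu,
    real_inner_comm (f u)] at h1
  linarith

lemma inner_pderiv_pderiv_self (hU : IsOpen U) (hf : ContDiffOn ℝ ∞ f U)
    (hs : ∀ u ∈ U, ‖f u‖ = 1) {u : E n} (hu : u ∈ U) (i j : Fin n) :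
    ⟪pderiv i (pderiv j f) u, f u⟫_ℝ = - metric f u i j := by
  have h1 := pderiv_inner (differentiableAt_of_contDiffOn hU hf hu)
    (differentiableAt_of_contDiffOn hU (contDiffOn_pderiv hU hf j) hu) i
  rw [pderiv_eq_zero_of_const hU (c := 0) (fun v hv => inner_pderiv_self hU hf hs hv j) i hu,
    real_inner_comm _ (f u)] at h1
  simp only [metric, Matrix.of_apply]
  linarith

lemma secondForm_symm (hU : IsOpen U) (hf : ContDiffOn ℝ ∞ f U) {u : E n} (hu : u ∈ U)
    (ν : E (n + 2)) (i j : Fin n) : secondForm f ν u i j = secondForm f ν u j i := by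
  simp only [secondForm, Matrix.of_apply]
  rw [pderiv_comm hU hf i j hu]

/-- The derivative of the Christoffel symbols in terms of the second fundamental form. -/
lemma sum_metric_mul_pderiv_christoffel (hU : IsOpen U) (hf : ContDiffOn ℝ ∞ f U)
    (himm : ∀ u ∈ U, Function.Injective (fderiv ℝ f u)) (hs : ∀ u ∈ U, ‖f u‖ = 1)
    {u : E n} (hu : u ∈ U) {ν : E (n + 2)} (hν : IsUnitNormal f u ν) (m k i j : Fin n) :
    ∑ p, metric f u m p * (pderiv k (christoffel (metric f) p i j) u +
        ∑ l, christoffel (metric f) p k l u * christoffel (metric f) l i j u) =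
      ⟪pderiv k (pderiv i (pderiv j f)) u, pderiv m f u⟫_ℝ
        + metric f u i j * metric f u k m + secondForm f ν u i j * secondForm f ν u k m := by
  have hd1 : ∀ i, DifferentiableAt ℝ (pderiv i f) u := fun i =>
    differentiableAt_of_contDiffOn hU (contDiffOn_pderiv hU hf i) hu
  have hd2 : DifferentiableAt ℝ (pderiv i (pderiv j f)) u :=
    differentiableAt_of_contDiffOn hU (contDiffOn_pderiv hU (contDiffOn_pderiv hU hf j) i) hu
  have hdg := differentiableAt_metric hU hf hu
  have hdΓ := differentiableAt_christoffel hU hf hu (himm u hu)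
  have e1 := pderiv_congr_of_eqOn hU
    (fun v hv => sum_metric_mul_christoffel hU hf hv (himm v hv) m i j) k hu
  rw [pderiv_sum _ (fun l _ => (hdg m l).fun_mul (hdΓ l i j)) k, pderiv_inner hd2 (hd1 m) k] at e1
  simp only [pderiv_mul (hdg m _) (hdΓ _ i j), pderiv_metric hU hf hu, Finset.sum_add_distrib,
    add_mul] at e1
  have e2 := inner_eq_frame (himm u hu) (hs u hu) (inner_pderiv_self hU hf hs hu) hν
    (pderiv i (pderiv j f) u) (pderiv k (pderiv m f) u)
  rw [inner_pderiv_pderiv_self hU hf hs hu, inner_pderiv_pderiv_self hU hf hs hu] at e2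
  have e3 : ∑ l, ∑ q, (metric f u)⁻¹ l q * ⟪pderiv i (pderiv j f) u, pderiv l f u⟫_ℝ *
      ⟪pderiv k (pderiv m f) u, pderiv q f u⟫_ℝ =
      ∑ l, ⟪pderiv k (pderiv m f) u, pderiv l f u⟫_ℝ * christoffel (metric f) l i j u := by
    rw [Finset.sum_comm]
    refine Finset.sum_congr rfl fun l _ => ?_
    rw [christoffel_metric hU hf hu, Finset.mul_sum]
    exact Finset.sum_congr rfl fun q _ => by rw [metric_inv_symm f u q l]; ring
  have e4 : ∑ p, metric f u m p *
      ∑ l, christoffel (metric f) p k l u * christoffel (metric f) l i j u =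
      ∑ l, ⟪pderiv m f u, pderiv k (pderiv l f) u⟫_ℝ * christoffel (metric f) l i j u := by
    simp only [Finset.mul_sum]
    rw [Finset.sum_comm]
    refine Finset.sum_congr rfl fun l _ => ?_
    rw [real_inner_comm, ← sum_metric_mul_christoffel hU hf hu (himm u hu), Finset.sum_mul]
    exact Finset.sum_congr rfl fun p _ => by ring
  simp only [mul_add, Finset.sum_add_distrib]
  rw [e4]
  simp only [secondForm, Matrix.of_apply] at e1 e2 ⊢
  rw [e3] at e2
  linarith

lemma riemann_eq (hU : IsOpen U) (hf : ContDiffOn ℝ ∞ f U)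
    (himm : ∀ u ∈ U, Function.Injective (fderiv ℝ f u)) (hs : ∀ u ∈ U, ‖f u‖ = 1)
    {u : E n} (hu : u ∈ U) {ν : E (n + 2)} (hν : IsUnitNormal f u ν) (p j k i : Fin n) :
    riemann (metric f) p j k i u =
      metric f u i j * (1 : Matrix (Fin n) (Fin n) ℝ) p k
        - metric f u k j * (1 : Matrix (Fin n) (Fin n) ℝ) p i
        + secondForm f ν u i j * ((metric f u)⁻¹ * secondForm f ν u) p k
        - secondForm f ν u k j * ((metric f u)⁻¹ * secondForm f ν u) p i := by
  have hinv := Matrix.nonsing_inv_mul (metric f u)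
    (isUnit_iff_ne_zero.2 (metric_det_ne_zero (himm u hu)))
  have h1 : metric f u *ᵥ (fun p => riemann (metric f) p j k i u) = fun m =>
      metric f u m k * metric f u i j - metric f u m i * metric f u k j
      + secondForm f ν u m k * secondForm f ν u i j
      - secondForm f ν u m i * secondForm f ν u k j := by
    funext m
    have e1 := sum_metric_mul_pderiv_christoffel hU hf himm hs hu hν m k i j
    have e2 := sum_metric_mul_pderiv_christoffel hU hf himm hs hu hν m i k j
    rw [pderiv_comm hU (contDiffOn_pderiv hU hf j) i k hu] at e2
    have e3 : (metric f u *ᵥ fun p => riemann (metric f) p j k i u) m =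
        ∑ p, metric f u m p * (pderiv k (christoffel (metric f) p i j) u +
          ∑ l, christoffel (metric f) p k l u * christoffel (metric f) l i j u) -
        ∑ p, metric f u m p * (pderiv i (christoffel (metric f) p k j) u +
          ∑ l, christoffel (metric f) p i l u * christoffel (metric f) l k j u) := by
      rw [← Finset.sum_sub_distrib]
      change ∑ p, metric f u m p * riemann (metric f) p j k i u = _
      refine Finset.sum_congr rfl fun p _ => ?_
      simp only [riemann, Finset.sum_sub_distrib]
      ring
    have hg : ∀ a b, metric f u a b = metric f u b a := fun a b =>
      congrFun (congrFun (metric_transpose f u) b) a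
    rw [e3, e1, e2, hg k m, hg i m, secondForm_symm hU hf hu ν k m,
      secondForm_symm hU hf hu ν i m]
    ring
  have h2 := congrFun (congrArg (fun w => (metric f u)⁻¹ *ᵥ w) h1) p
  simp only [Matrix.mulVec_mulVec, hinv, Matrix.one_mulVec] at h2
  rw [h2, ← hinv]
  simp only [Matrix.mulVec, dotProduct, Matrix.mul_apply, Finset.mul_sum,
    ← Finset.sum_add_distrib, ← Finset.sum_sub_distrib]
  exact Finset.sum_congr rfl fun m _ => by ring

/-- The shape operator of a parametrized hypersurface. -/
noncomputable def shape (f : E n → E (n + 2)) (ν : E (n + 2)) (u : E n) : Matrix (Fin n) (Fin n) ℝ :=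
  (metric f u)⁻¹ * secondForm f ν u

/-- The Ricci operator of a metric. -/
noncomputable def ricciOperator {d : ℕ} (g : E d → Matrix (Fin d) (Fin d) ℝ) (u : E d) :
    Matrix (Fin d) (Fin d) ℝ :=
  (g u)⁻¹ * Matrix.of fun k j => ricci g k j u

lemma scalarCurvature_eq_trace {d : ℕ} {g : E d → Matrix (Fin d) (Fin d) ℝ} {u : E d}
    (hg : ∀ j, ∀ k, ricci g j k u = ricci g k j u) :
    scalarCurvature g u = (ricciOperator g u).trace := by
  simp only [scalarCurvature, ricciOperator, Matrix.trace, Matrix.diag, Matrix.mul_apply,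
    Matrix.of_apply]
  exact Finset.sum_congr rfl fun k _ => Finset.sum_congr rfl fun j _ => by rw [hg]

lemma secondForm_transpose (hU : IsOpen U) (hf : ContDiffOn ℝ ∞ f U) {u : E n} (hu : u ∈ U)
    (ν : E (n + 2)) : (secondForm f ν u)ᵀ = secondForm f ν u := by
  ext i j
  exact secondForm_symm hU hf hu ν j i

lemma ricci_eq (hU : IsOpen U) (hf : ContDiffOn ℝ ∞ f U)
    (himm : ∀ u ∈ U, Function.Injective (fderiv ℝ f u)) (hs : ∀ u ∈ U, ‖f u‖ = 1)
    {u : E n} (hu : u ∈ U) {ν : E (n + 2)} (hν : IsUnitNormal f u ν) :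
    (Matrix.of fun k j => ricci (metric f) k j u) =
      ((n : ℝ) - 1) • metric f u + (shape f ν u).trace • secondForm f ν u
        - secondForm f ν u * (metric f u)⁻¹ * secondForm f ν u := by
  ext k j
  have hg : ∀ a b, metric f u a b = metric f u b a := fun a b =>
      congrFun (congrFun (metric_transpose f u) b) a
  simp only [Matrix.of_apply, ricci, riemann_eq hU hf himm hs hu hν, Finset.sum_add_distrib,
    Finset.sum_sub_distrib, Matrix.sub_apply, Matrix.add_apply, Matrix.smul_apply, smul_eq_mul]
  rw [← Finset.mul_sum, ← Finset.mul_sum, Matrix.mul_assoc, Matrix.mul_apply]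
  have h1 : ∑ l, metric f u l k * (1 : Matrix (Fin n) (Fin n) ℝ) l j = metric f u k j := by
    simp [Matrix.one_apply, hg k j]
  have h2 : ∑ l, secondForm f ν u l k * ((metric f u)⁻¹ * secondForm f ν u) l j =
      ∑ l, secondForm f ν u k l * ((metric f u)⁻¹ * secondForm f ν u) l j :=
    Finset.sum_congr rfl fun l _ => by rw [secondForm_symm hU hf hu ν l k]
  rw [h1, h2, secondForm_symm hU hf hu ν j k, hg j k]
  simp only [Matrix.one_apply_eq, Finset.sum_const, Finset.card_univ, Fintype.card_fin,
    nsmul_eq_mul, mul_one, shape, Matrix.trace, Matrix.diag]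
  ring

lemma ricciOperator_eq (hU : IsOpen U) (hf : ContDiffOn ℝ ∞ f U)
    (himm : ∀ u ∈ U, Function.Injective (fderiv ℝ f u)) (hs : ∀ u ∈ U, ‖f u‖ = 1)
    {u : E n} (hu : u ∈ U) {ν : E (n + 2)} (hν : IsUnitNormal f u ν) :
    ricciOperator (metric f) u = ((n : ℝ) - 1) • (1 : Matrix (Fin n) (Fin n) ℝ)
      + (shape f ν u).trace • shape f ν u - shape f ν u * shape f ν u := by
  rw [ricciOperator, ricci_eq hU hf himm hs hu hν, mul_sub, mul_add, Matrix.mul_smul,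
    Matrix.mul_smul, Matrix.nonsing_inv_mul (metric f u)
    (isUnit_iff_ne_zero.2 (metric_det_ne_zero (himm u hu)))]
  simp only [shape, Matrix.mul_assoc]

lemma scalarCurvature_eq (hU : IsOpen U) (hf : ContDiffOn ℝ ∞ f U)
    (himm : ∀ u ∈ U, Function.Injective (fderiv ℝ f u)) (hs : ∀ u ∈ U, ‖f u‖ = 1)
    {u : E n} (hu : u ∈ U) {ν : E (n + 2)} (hν : IsUnitNormal f u ν) :
    scalarCurvature (metric f) u = (n : ℝ) * ((n : ℝ) - 1) + (shape f ν u).trace ^ 2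
      - (shape f ν u * shape f ν u).trace := by
  rw [scalarCurvature_eq_trace, ricciOperator_eq hU hf himm hs hu hν]
  · simp only [Matrix.trace_sub, Matrix.trace_add, Matrix.trace_smul, Matrix.trace_one,
      Fintype.card_fin, smul_eq_mul]
    ring
  · intro j k
    have h := ricci_eq hU hf himm hs hu hν
    have ht : (Matrix.of fun k j => ricci (metric f) k j u)ᵀ =
        Matrix.of fun k j => ricci (metric f) k j u := by
      rw [h]
      simp only [Matrix.transpose_sub, Matrix.transpose_add, Matrix.transpose_smul,
        Matrix.transpose_mul, metric_transpose, metric_inv_transpose,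
        secondForm_transpose hU hf hu, Matrix.mul_assoc]
    exact congrFun (congrFun ht k) j

end Gauss

/-! ### Rank-one perturbations of scalar matrices -/

section RankOne

lemma esymm_one_eq_sum {R : Type} [CommSemiring R] (s : Multiset R) : s.esymm 1 = s.sum := by
  simp [Multiset.esymm, Multiset.powersetCard_one]

lemma esymm_two_cons {R : Type} [CommSemiring R] (a : R) (s : Multiset R) :
    (a ::ₘ s).esymm 2 = s.esymm 2 + a * s.sum := by
  have h : ((Multiset.powersetCard 1 s).map fun t => a * t.prod).sum = a * s.esymm 1 := by
    rw [Multiset.sum_map_mul_left, Multiset.esymm]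
  simp only [Multiset.esymm, Multiset.powersetCard_cons, Multiset.map_add, Multiset.sum_add,
    Multiset.map_map, Function.comp_def, Multiset.prod_cons]
  rw [h, esymm_one_eq_sum]

lemma esymm_two_replicate (m : ℕ) (a : ℝ) :
    (Multiset.replicate m a).esymm 2 = (m : ℝ) * ((m : ℝ) - 1) / 2 * a ^ 2 := by
  induction m with
  | zero => simp [Multiset.esymm, Multiset.powersetCard_zero_right]
  | succ m ih =>
    rw [Multiset.replicate_succ, esymm_two_cons, ih, Multiset.sum_replicate]
    push_cast
    simp only [nsmul_eq_mul]
    ring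

variable {n : ℕ} {S : Matrix (Fin n) (Fin n) ℝ} {x y : Fin n → ℝ} {l δ : ℝ}

open Polynomial in
lemma charpoly_roots_scalar_add_vecMulVec (hn : 1 ≤ n) (hxy : x ⬝ᵥ y = 1)
    (hS : S = l • 1 + δ • Matrix.vecMulVec x y) :
    S.charpoly.roots = (l + δ) ::ₘ Multiset.replicate (n - 1) l := by
  have h1 := Matrix.charpoly_sub_scalar S l
  have h2 : S - Matrix.scalar (Fin n) l = Matrix.vecMulVec (δ • x) y := by
    rw [hS, Matrix.smul_vecMulVec, Matrix.scalar_apply, ← Matrix.smul_one_eq_diagonal]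
    abel
  rw [h2, Matrix.charpoly_vecMulVec, Fintype.card_fin, smul_dotProduct, hxy] at h1
  have h3 : S.charpoly = (X - C l) ^ (n - 1) * (X - C (l + δ)) := by
    have h4 := congrArg (fun q : ℝ[X] => q.comp (X - C l)) h1
    simp only [comp_assoc, add_comp, X_comp, C_comp, sub_add_cancel, comp_X] at h4
    rw [← h4]
    obtain ⟨m, rfl⟩ : ∃ m, n = m + 1 := ⟨n - 1, by omega⟩
    simp only [Nat.add_sub_cancel, sub_comp, mul_comp, pow_comp, X_comp, C_comp, smul_eq_mul,
      mul_one, smul_eq_C_mul, C_add]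
    ring
  have hne : (X - C l) ^ (n - 1) * (X - C (l + δ)) ≠ 0 :=
    mul_ne_zero (pow_ne_zero _ (X_sub_C_ne_zero l)) (X_sub_C_ne_zero _)
  rw [h3, roots_mul hne, roots_pow, roots_X_sub_C, roots_X_sub_C, Multiset.nsmul_singleton,
    add_comm, Multiset.singleton_add]

lemma trace_scalar_add_vecMulVec (hxy : x ⬝ᵥ y = 1)
    (hS : S = l • 1 + δ • Matrix.vecMulVec x y) : S.trace = n * l + δ := by
  rw [hS, Matrix.trace_add, Matrix.trace_smul, Matrix.trace_smul, Matrix.trace_vecMulVec, hxy,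
    Matrix.trace_one, Fintype.card_fin]
  simp only [smul_eq_mul]
  ring

lemma mul_self_scalar_add_vecMulVec (hxy : x ⬝ᵥ y = 1)
    (hS : S = l • 1 + δ • Matrix.vecMulVec x y) :
    S * S = (l ^ 2) • 1 + (2 * l * δ + δ ^ 2) • Matrix.vecMulVec x y := by
  have h : Matrix.vecMulVec x y * Matrix.vecMulVec x y = Matrix.vecMulVec x y := by
    rw [Matrix.vecMulVec_mul_vecMulVec, dotProduct_comm, hxy, one_smul]
  rw [hS]
  simp only [add_mul, mul_add, Matrix.smul_mul, Matrix.mul_smul, h, Matrix.one_mul, Matrix.mul_one]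
  module

end RankOne

/-! ### The squared norm of the Ricci tensor -/

/-- The squared norm of the Ricci tensor of a metric. -/
noncomputable def ricciNormSq {d : ℕ} (g : E d → Matrix (Fin d) (Fin d) ℝ) (u : E d) : ℝ :=
  (ricciOperator g u * ricciOperator g u).trace

lemma ricciNormSq_congr {d : ℕ} {U : Set (E d)} (hU : IsOpen U)
    {g g' : E d → Matrix (Fin d) (Fin d) ℝ} (h : ∀ u ∈ U, g u = g' u) {u : E d} (hu : u ∈ U) :
    ricciNormSq g u = ricciNormSq g' u := by
  have hc : ∀ l i j, Set.EqOn (christoffel g l i j) (christoffel g' l i j) U := by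
    intro l i j v hv
    have hp : ∀ a b c, pderiv a (fun w => g w b c) v = pderiv a (fun w => g' w b c) v :=
      fun a b c => pderiv_congr_of_eqOn hU (F := fun w => g w b c) (F' := fun w => g' w b c)
        (fun w hw => by simp only [h w hw]) a hv
    simp only [christoffel, h v hv, hp]
  have hr : ∀ k j, ricci g k j u = ricci g' k j u := by
    intro k j
    simp only [ricci, riemann]
    refine Finset.sum_congr rfl fun l _ => ?_
    rw [pderiv_congr_of_eqOn hU (hc l j k) l hu, pderiv_congr_of_eqOn hU (hc l l k) j hu]
    simp only [hc _ _ _ hu]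
  simp only [ricciNormSq, ricciOperator, hr, h u hu]

section Umbilic

variable {n : ℕ} {U : Set (E n)} {f : E n → E (n + 2)} {u : E n} {ν : E (n + 2)} {l δ : ℝ}
  {y : Fin n → ℝ}

lemma shape_eq_of_secondForm_eq (himm : Function.Injective (fderiv ℝ f u))
    (h : secondForm f ν u = l • metric f u + δ • Matrix.vecMulVec y y) :
    shape f ν u = l • 1 + δ • Matrix.vecMulVec ((metric f u)⁻¹ *ᵥ y) y := by
  rw [shape, h, mul_add, Matrix.mul_smul, Matrix.mul_smul, Matrix.nonsing_inv_mul (metric f u)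
    (isUnit_iff_ne_zero.2 (metric_det_ne_zero himm)), Matrix.mul_vecMulVec]

lemma mthMeanCurvature_two_of_secondForm_eq (hn : 2 ≤ n)
    (himm : Function.Injective (fderiv ℝ f u))
    (h : secondForm f ν u = l • metric f u + δ • Matrix.vecMulVec y y)
    (hy : ((metric f u)⁻¹ *ᵥ y) ⬝ᵥ y = 1) :
    mthMeanCurvature 2 f ν u = (n * l ^ 2 + 2 * l * δ) / n := by
  have hroots := charpoly_roots_scalar_add_vecMulVec (by omega) hy
    (shape_eq_of_secondForm_eq himm h)
  have hn' : (n : ℝ) ≠ 0 := by positivity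
  have hn1 : (n : ℝ) - 1 ≠ 0 := by
    have : (2 : ℝ) ≤ n := by exact_mod_cast hn
    linarith
  unfold mthMeanCurvature principalCurvatures
  change (shape f ν u).charpoly.roots.esymm 2 / _ = _
  rw [hroots, esymm_two_cons, esymm_two_replicate, Multiset.sum_replicate, Nat.cast_choose_two,
    Nat.cast_sub (by omega)]
  simp only [nsmul_eq_mul]
  rw [Nat.cast_sub (by omega)]
  push_cast
  field_simp
  ring

lemma scalarCurvature_of_secondForm_eq (hU : IsOpen U) (hf : ContDiffOn ℝ ∞ f U)
    (himm : ∀ u ∈ U, Function.Injective (fderiv ℝ f u)) (hs : ∀ u ∈ U, ‖f u‖ = 1)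
    (hu : u ∈ U) (hν : IsUnitNormal f u ν)
    (h : secondForm f ν u = l • metric f u + δ • Matrix.vecMulVec y y)
    (hy : ((metric f u)⁻¹ *ᵥ y) ⬝ᵥ y = 1) :
    scalarCurvature (metric f) u = (n - 1) * (n + (n * l ^ 2 + 2 * l * δ)) := by
  have hS := shape_eq_of_secondForm_eq (himm u hu) h
  rw [scalarCurvature_eq hU hf himm hs hu hν, trace_scalar_add_vecMulVec hy hS,
    trace_scalar_add_vecMulVec hy (mul_self_scalar_add_vecMulVec hy hS)]
  ring

lemma ricciNormSq_of_secondForm_eq (hU : IsOpen U) (hf : ContDiffOn ℝ ∞ f U)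
    (himm : ∀ u ∈ U, Function.Injective (fderiv ℝ f u)) (hs : ∀ u ∈ U, ‖f u‖ = 1)
    (hu : u ∈ U) (hν : IsUnitNormal f u ν)
    (h : secondForm f ν u = l • metric f u + δ • Matrix.vecMulVec y y)
    (hy : ((metric f u)⁻¹ *ᵥ y) ⬝ᵥ y = 1) :
    n * ricciNormSq (metric f) u = ((n - 1) * (n + (n * l ^ 2 + 2 * l * δ))) ^ 2
      + (n - 1) * ((n - 2) * l * δ) ^ 2 := by
  have hS := shape_eq_of_secondForm_eq (himm u hu) h
  have hR : ricciOperator (metric f) u = ((n : ℝ) - 1 + (n - 1) * l ^ 2 + l * δ) • 1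
      + ((n - 2) * l * δ) • Matrix.vecMulVec ((metric f u)⁻¹ *ᵥ y) y := by
    rw [ricciOperator_eq hU hf himm hs hu hν, mul_self_scalar_add_vecMulVec hy hS,
      trace_scalar_add_vecMulVec hy hS, hS]
    module
  rw [ricciNormSq, trace_scalar_add_vecMulVec hy (mul_self_scalar_add_vecMulVec hy hR)]
  ring

/-- The norm of the Ricci tensor of a hypersurface whose shape operator satisfies a quadratic
equation. -/
lemma ricciNormSq_of_shape_mul_self (hU : IsOpen U) (hf : ContDiffOn ℝ ∞ f U)
    (himm : ∀ u ∈ U, Function.Injective (fderiv ℝ f u)) (hs : ∀ u ∈ U, ‖f u‖ = 1)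
    (hu : u ∈ U) (hν : IsUnitNormal f u ν) {α β T : ℝ}
    (hS : shape f ν u * shape f ν u = α • shape f ν u + β • 1) (hT : (shape f ν u).trace = T) :
    ricciNormSq (metric f) u = n * (n - 1 - β) ^ 2 + 2 * (n - 1 - β) * (T - α) * T
      + (T - α) ^ 2 * (α * T + n * β) := by
  have hR : ricciOperator (metric f) u = ((n : ℝ) - 1 - β) • 1 + (T - α) • shape f ν u := by
    rw [ricciOperator_eq hU hf himm hs hu hν, hS, hT]
    module
  have hRR : ricciOperator (metric f) u * ricciOperator (metric f) u =
      ((n - 1 - β) ^ 2 + (T - α) ^ 2 * β) • 1 + (2 * (n - 1 - β) * (T - α)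
        + (T - α) ^ 2 * α) • shape f ν u := by
    rw [hR]
    simp only [add_mul, mul_add, Matrix.smul_mul, Matrix.mul_smul, hS, Matrix.one_mul,
      Matrix.mul_one]
    module
  rw [ricciNormSq, hRR, Matrix.trace_add, Matrix.trace_smul, Matrix.trace_smul, hT,
    Matrix.trace_one, Fintype.card_fin]
  simp only [smul_eq_mul]
  ring

end Umbilic

/-! ### Round spheres and Clifford hypersurfaces -/

lemma exists_ricciNormSq_roundSphere (n : ℕ) {c : ℝ} (hc : -1 < c) (hc' : c < 1) :
    ∃ K : ℝ, ∀ (U : Set (E n)) (f : E n → E (n + 2)), IsLocalParam (roundSphere n c) U f →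
      ∀ u ∈ U, ricciNormSq (metric f) u = K := by
  set s := √(1 - c ^ 2)
  have hpos : 0 < 1 - c ^ 2 := by nlinarith
  have hs0 : 0 < s := Real.sqrt_pos.2 hpos
  have hss : s ^ 2 = 1 - c ^ 2 := Real.sq_sqrt hpos.le
  set e : E (n + 2) := EuclideanSpace.single (Fin.last (n + 1)) 1 with he
  refine ⟨n * (n - 1 - (- (c / s) ^ 2)) ^ 2 + 2 * (n - 1 - (- (c / s) ^ 2)) *
    (n * (c / s) - 2 * (c / s)) * (n * (c / s)) + (n * (c / s) - 2 * (c / s)) ^ 2 *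
    (2 * (c / s) * (n * (c / s)) + n * (- (c / s) ^ 2)), fun U f hf u hu => ?_⟩
  have hU := hf.isOpen_source
  have hsm := hf.contDiffOn
  have hmem : ∀ v ∈ U, f v ∈ roundSphere n c := fun v hv => by
    obtain ⟨V, -, hV⟩ := hf.image_open
    exact (hV ▸ Set.mem_image_of_mem f hv : f v ∈ roundSphere n c ∩ V).1
  have hs : ∀ v ∈ U, ‖f v‖ = 1 := fun v hv => mem_sphere_zero_iff_norm.1 (hmem v hv).1
  have hfe : ∀ v ∈ U, ⟪f v, e⟫_ℝ = c := fun v hv => by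
    simpa [he, EuclideanSpace.inner_single_right] using (hmem v hv).2
  have h1 : ∀ i, ∀ v ∈ U, ⟪pderiv i f v, e⟫_ℝ = 0 := fun i v hv => by
    have := pderiv_inner (differentiableAt_of_contDiffOn hU hsm hv) (differentiableAt_const e) i
    rw [pderiv_eq_zero_of_const hU hfe i hv] at this
    simpa [pderiv] using this.symm
  have h2 : ∀ i j, ⟪pderiv i (pderiv j f) u, e⟫_ℝ = 0 := fun i j => by
    have := pderiv_inner (differentiableAt_of_contDiffOn hU (contDiffOn_pderiv hU hsm j) hu)
      (differentiableAt_const e) i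
    rw [pderiv_eq_zero_of_const hU (h1 j) i hu] at this
    simpa [pderiv] using this.symm
  have hff : ⟪f u, f u⟫_ℝ = 1 := by rw [real_inner_self_eq_norm_sq, hs u hu, one_pow]
  have hee : ⟪e, e⟫_ℝ = 1 := by simp [he]
  have hν : IsUnitNormal f u (s⁻¹ • (e - c • f u)) := by
    refine ⟨?_, ?_, fun i => ?_⟩
    · have : ‖s⁻¹ • (e - c • f u)‖ ^ 2 = 1 := by
        rw [← real_inner_self_eq_norm_sq]
        simp only [inner_smul_left, inner_smul_right, inner_sub_left, inner_sub_right, hff, hee,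
          hfe u hu, real_inner_comm (f u) e, conj_trivial]
        field_simp
        rw [hss]
        ring
      exact (pow_eq_one_iff_of_nonneg (norm_nonneg _) two_ne_zero).1 this
    · rw [inner_smul_right, inner_sub_right, inner_smul_right, hfe u hu, hff]
      ring
    · rw [inner_smul_right, inner_sub_right, inner_smul_right, h1 i u hu, real_inner_comm,
        inner_pderiv_self hU hsm hs hu]
      ring
  have hh : secondForm f (s⁻¹ • (e - c • f u)) u = (c / s) • metric f u := by
    ext i j
    simp only [secondForm, Matrix.of_apply, inner_smul_right, inner_sub_right, h2,
      inner_pderiv_pderiv_self hU hsm hs hu, Matrix.smul_apply, smul_eq_mul]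
    ring
  have hS : shape f (s⁻¹ • (e - c • f u)) u = (c / s) • 1 := by
    rw [shape, hh, Matrix.mul_smul, Matrix.nonsing_inv_mul (metric f u)
      (isUnit_iff_ne_zero.2 (metric_det_ne_zero (hf.immersion u hu)))]
  refine ricciNormSq_of_shape_mul_self hU hsm hf.immersion hs hu hν ?_ ?_
  · rw [hS, Matrix.smul_mul, Matrix.one_mul]
    module
  · rw [hS, Matrix.trace_smul, Matrix.trace_one, Fintype.card_fin, smul_eq_mul]
    ring

lemma exists_ricciNormSq_cliffordHypersurface (n l : ℕ) {a b : ℝ} (ha : 0 < a) (hb : 0 < b)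
    (hab : a ^ 2 + b ^ 2 = 1) :
    ∃ K : ℝ, ∀ (U : Set (E n)) (f : E n → E (n + 2)),
      IsLocalParam (cliffordHypersurface n l a b) U f →
      ∀ u ∈ U, ricciNormSq (metric f) u = K := by
  set β : Fin (n + 2) → ℝ := fun i => if i.val ≤ l then b / a else - (a / b) with hβ
  set A : E (n + 2) →L[ℝ] E (n + 2) := Matrix.toEuclideanCLM (𝕜 := ℝ) (Matrix.diagonal β) with hA
  have hAi : ∀ x i, A x i = β i * x i := fun x i => by
    simp [hA, Matrix.ofLp_toEuclideanCLM, Matrix.mulVec_diagonal]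
  have hAxy : ∀ x y, ⟪A x, y⟫_ℝ = ∑ i, β i * x i * y i := fun x y => by
    simp only [PiLp.inner_apply, hAi, RCLike.inner_apply, conj_trivial]
    exact Finset.sum_congr rfl fun i _ => by ring
  have hsymm : ∀ x y, ⟪A x, y⟫_ℝ = ⟪x, A y⟫_ℝ := fun x y => by
    rw [real_inner_comm (A y) x, hAxy, hAxy]
    exact Finset.sum_congr rfl fun i _ => by ring
  set δ := b / a - a / b with hδ
  have hββ : ∀ i, β i * β i = δ * β i + 1 := fun i => by
    simp only [hβ, hδ]
    split_ifs <;> field_simp <;> ring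
  have hA2 : ∀ x, A (A x) = δ • A x + x := fun x => by
    ext i
    simp only [hAi, PiLp.add_apply, PiLp.smul_apply, smul_eq_mul]
    linear_combination x i * hββ i
  set T := - (∑ i, β i - δ) with hT
  refine ⟨n * (n - 1 - 1) ^ 2 + 2 * (n - 1 - 1) * (T - -δ) * T
      + (T - -δ) ^ 2 * (-δ * T + n * 1), fun U f hf u hu => ?_⟩
  have hU := hf.isOpen_source
  have hsm := hf.contDiffOn
  have hmem : ∀ v ∈ U, f v ∈ cliffordHypersurface n l a b := fun v hv => by
    obtain ⟨V, -, hV⟩ := hf.image_open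
    exact (hV ▸ Set.mem_image_of_mem f hv : f v ∈ cliffordHypersurface n l a b ∩ V).1
  have hff : ∀ v ∈ U, ⟪f v, f v⟫_ℝ = 1 := fun v hv => by
    rw [PiLp.inner_apply, ← hab, ← (hmem v hv).1, ← (hmem v hv).2, ← Finset.sum_add_distrib]
    refine Finset.sum_congr rfl fun i _ => ?_
    simp only [RCLike.inner_apply, conj_trivial]
    split_ifs <;> ring
  have hs : ∀ v ∈ U, ‖f v‖ = 1 := fun v hv =>
    (pow_eq_one_iff_of_nonneg (norm_nonneg _) two_ne_zero).1
      (by rw [← real_inner_self_eq_norm_sq, hff v hv])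
  have hAff : ∀ v ∈ U, ⟪A (f v), f v⟫_ℝ = 0 := fun v hv => by
    have : ⟪A (f v), f v⟫_ℝ = b / a * a ^ 2 - a / b * b ^ 2 := by
      rw [hAxy, ← (hmem v hv).1, ← (hmem v hv).2, Finset.mul_sum, Finset.mul_sum,
        ← Finset.sum_sub_distrib]
      refine Finset.sum_congr rfl fun i _ => ?_
      simp only [hβ]
      split_ifs <;> ring
    rw [this]
    field_simp
    ring
  have hdf : ∀ v ∈ U, DifferentiableAt ℝ f v := fun v hv =>
    differentiableAt_of_contDiffOn hU hsm hv
  have hdAf : ∀ v ∈ U, ∀ i, DifferentiableAt ℝ (fun w => A (f w)) v ∧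
      pderiv i (fun w => A (f w)) v = A (pderiv i f v) := fun v hv i => by
    have := A.hasFDerivAt.comp v (hdf v hv).hasFDerivAt
    exact ⟨this.differentiableAt, by rw [pderiv]; erw [this.fderiv]; rfl⟩
  have h1 : ∀ i, ∀ v ∈ U, ⟪pderiv i f v, A (f v)⟫_ℝ = 0 := fun i v hv => by
    have := pderiv_inner (hdAf v hv i).1 (hdf v hv) i
    rw [pderiv_eq_zero_of_const hU hAff i hv, (hdAf v hv i).2, hsymm,
      real_inner_comm (pderiv i f v) (A (f v))] at this
    linarith
  have h2 : ∀ i j, ⟪pderiv i (pderiv j f) u, A (f u)⟫_ℝ = - ⟪A (pderiv i f u), pderiv j f u⟫_ℝ :=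
    fun i j => by
    have := pderiv_inner (differentiableAt_of_contDiffOn hU (contDiffOn_pderiv hU hsm j) hu)
      (hdAf u hu i).1 i
    rw [pderiv_eq_zero_of_const hU (h1 j) i hu, (hdAf u hu i).2,
      real_inner_comm _ (pderiv j f u)] at this
    linarith
  have hν : IsUnitNormal f u (A (f u)) := by
    refine ⟨?_, ?_, fun i => h1 i u hu⟩
    · have : ‖A (f u)‖ ^ 2 = 1 := by
        rw [← real_inner_self_eq_norm_sq, ← hsymm, hA2, inner_add_left, inner_smul_left, hff u hu,
          hAff u hu]
        simp
      exact (pow_eq_one_iff_of_nonneg (norm_nonneg _) two_ne_zero).1 this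
    · rw [← hsymm, hAff u hu]
  have himm := hf.immersion u hu
  have hframe := inner_eq_frame himm (hs u hu) (inner_pderiv_self hU hsm hs hu) hν
  have hinv := Matrix.nonsing_inv_mul (metric f u) (isUnit_iff_ne_zero.2 (metric_det_ne_zero himm))
  have hJA : ∀ i, ⟪A (pderiv i f u), f u⟫_ℝ = 0 := fun i => by rw [hsymm, h1 i u hu]
  have hJAν : ∀ i, ⟪A (pderiv i f u), A (f u)⟫_ℝ = 0 := fun i => by
    rw [hsymm, hA2, inner_add_right, inner_smul_right, h1 i u hu, real_inner_comm,
      inner_pderiv_self hU hsm hs hu]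
    simp
  have hhgh : secondForm f (A (f u)) u * (metric f u)⁻¹ * secondForm f (A (f u)) u =
      (-δ) • secondForm f (A (f u)) u + (1 : ℝ) • metric f u := by
    ext i j
    have h3 := hframe (A (pderiv i f u)) (A (pderiv j f u))
    rw [hJA, hJAν, hsymm, hA2, inner_add_right, inner_smul_right, ← hsymm] at h3
    rw [Matrix.mul_assoc, Matrix.mul_apply]
    simp only [Matrix.mul_apply, Finset.mul_sum, secondForm, Matrix.of_apply, h2,
      Matrix.add_apply, Matrix.smul_apply, smul_eq_mul, metric, one_mul]
    simp only [metric] at h3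
    calc _ = _ := ?_
      _ = _ := h3.symm.trans (by ring)
    rw [zero_mul, zero_mul, add_zero, add_zero]
    refine Finset.sum_congr rfl fun p _ => Finset.sum_congr rfl fun q _ => ?_
    rw [hsymm (pderiv q f u), real_inner_comm (A (pderiv j f u))]
    ring
  refine ricciNormSq_of_shape_mul_self hU hsm hf.immersion hs hu hν ?_ ?_
  · have := congrArg (fun B => (metric f u)⁻¹ * B) hhgh
    simp only [mul_add, Matrix.mul_smul, hinv] at this
    refine Eq.trans ?_ this
    simp only [shape, Matrix.mul_assoc]
  · have htr : ∀ x y, ∑ q, ⟪A (EuclideanSpace.single q (1 : ℝ)), x⟫_ℝ *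
        ⟪EuclideanSpace.single q (1 : ℝ), y⟫_ℝ = ⟪A x, y⟫_ℝ := fun x y => by
      rw [hAxy]
      refine Finset.sum_congr rfl fun q _ => ?_
      rw [hsymm, EuclideanSpace.inner_single_left, EuclideanSpace.inner_single_left, hAi]
      simp
    have h4 : ∑ q, β q = ∑ q, ⟪A (EuclideanSpace.single q (1 : ℝ)),
        EuclideanSpace.single q (1 : ℝ)⟫_ℝ := by
      refine Finset.sum_congr rfl fun q _ => ?_
      rw [EuclideanSpace.inner_single_right, hAi]
      simp
    have h7 := fun q => hframe (A (EuclideanSpace.single q (1 : ℝ))) (EuclideanSpace.single q 1)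
    simp only [h7, Finset.sum_add_distrib, htr] at h4
    rw [Finset.sum_comm] at h4
    have h5 : ∀ p, ∑ q, ∑ m, (metric f u)⁻¹ p m *
        ⟪A (EuclideanSpace.single q (1 : ℝ)), pderiv p f u⟫_ℝ *
        ⟪EuclideanSpace.single q (1 : ℝ), pderiv m f u⟫_ℝ =
        ∑ m, (metric f u)⁻¹ p m * ⟪A (pderiv p f u), pderiv m f u⟫_ℝ := fun p => by
      rw [Finset.sum_comm]
      refine Finset.sum_congr rfl fun m _ => ?_
      rw [← htr, Finset.mul_sum]
      exact Finset.sum_congr rfl fun q _ => by ring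
    simp only [h5] at h4
    have h6 : ⟪A (A (f u)), A (f u)⟫_ℝ = δ := by
      rw [hA2, inner_add_left, inner_smul_left, real_inner_self_eq_norm_sq, hν.norm_eq_one,
        ← hsymm, hAff u hu]
      simp
    rw [hAff u hu, h6] at h4
    rw [hT, h4]
    simp only [shape, Matrix.trace, Matrix.diag, Matrix.mul_apply, secondForm, Matrix.of_apply, h2,
      mul_neg, Finset.sum_neg_distrib]
    rw [add_zero, add_sub_cancel_right]
    congr 1
    refine Finset.sum_congr rfl fun p _ => Finset.sum_congr rfl fun q _ => ?_
    rw [hsymm, real_inner_comm]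

/-! ### The splitting `ℝ^{n+2} = ℂ × ℝ^n` -/

section Splitting

variable {n : ℕ}

/-- The inclusion `ℂ × ℝ^n → ℝ^{n+2}`. -/
noncomputable def join : ℂ × E n →L[ℝ] E (n + 2) :=
  LinearMap.toContinuousLinearMap
    { toFun := fun q => WithLp.toLp 2 (Fin.cons q.1.re (Fin.cons q.1.im q.2))
      map_add' := fun q q' => by
        ext i
        refine Fin.cases ?_ (fun i => Fin.cases ?_ (fun i => ?_) i) i <;> simp
      map_smul' := fun a q => by
        ext i
        refine Fin.cases ?_ (fun i => Fin.cases ?_ (fun i => ?_) i) i <;> simp }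

/-- The projection `ℝ^{n+2} → ℂ`. -/
noncomputable def fstPart : E (n + 2) →L[ℝ] ℂ :=
  LinearMap.toContinuousLinearMap
    { toFun := fun p => ⟨p 0, p 1⟩
      map_add' := fun q q' => by apply Complex.ext <;> simp
      map_smul' := fun a q => by apply Complex.ext <;> simp }

/-- The projection `ℝ^{n+2} → ℝ^n`. -/
noncomputable def sndPart : E (n + 2) →L[ℝ] E n :=
  LinearMap.toContinuousLinearMap
    { toFun := fun p => WithLp.toLp 2 fun i => p i.succ.succ
      map_add' := fun q q' => by ext; simp
      map_smul' := fun a q => by ext; simp }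

lemma fstPart_join (z : ℂ) (y : E n) : fstPart (join (z, y)) = z := rfl

lemma sndPart_join (z : ℂ) (y : E n) : sndPart (join (z, y)) = y := by
  ext i
  simp [sndPart, join]

lemma inner_join (z z' : ℂ) (y y' : E n) :
    ⟪join (z, y), join (z', y')⟫_ℝ = (z' * (starRingEnd ℂ) z).re + ⟪y, y'⟫_ℝ := by
  simp only [PiLp.inner_apply, Fin.sum_univ_succ, join]
  simp
  ring

lemma inner_join_mul_exp (a b : ℂ) (θ : ℝ) (y y' : E n) :
    ⟪join (a * Complex.exp (θ * Complex.I), y), join (b * Complex.exp (θ * Complex.I), y')⟫_ℝ =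
      a.re * b.re + a.im * b.im + ⟪y, y'⟫_ℝ := by
  have h : b * Complex.exp (θ * Complex.I) * (starRingEnd ℂ) (a * Complex.exp (θ * Complex.I))
      = b * (starRingEnd ℂ) a := by
    rw [map_mul, ← Complex.exp_conj, mul_mul_mul_comm, ← Complex.exp_add]
    simp
  rw [inner_join, h]
  simp
  ring

/-- The partial derivative of a map of the form `u ↦ (Z (θ u), ρ (θ u) η(u))`. -/
lemma pderiv_join {d : ℕ} {Z : ℝ → ℂ} {ρ : ℝ → ℝ} {θ : E d → ℝ} {η : E d → E n} {u : E d}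
    {Z' : ℂ} {ρ' : ℝ} (hZ : HasDerivAt Z Z' (θ u)) (hρ : HasDerivAt ρ ρ' (θ u))
    (hθ : DifferentiableAt ℝ θ u) (hη : DifferentiableAt ℝ η u) (i : Fin d) :
    DifferentiableAt ℝ (fun u => join (Z (θ u), ρ (θ u) • η u)) u ∧
    pderiv i (fun u => join (Z (θ u), ρ (θ u) • η u)) u =
      join (pderiv i θ u • Z', (pderiv i θ u * ρ') • η u + ρ (θ u) • pderiv i η u) := by
  have h1 := hZ.hasFDerivAt.comp u hθ.hasFDerivAt
  have h2 := (hρ.comp_hasFDerivAt u hθ.hasFDerivAt).smul hη.hasFDerivAt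
  have h3 : HasFDerivAt (fun u => join (Z (θ u), ρ (θ u) • η u)) _ u :=
    join.hasFDerivAt.comp u (h1.prodMk h2)
  refine ⟨h3.differentiableAt, ?_⟩
  rw [pderiv, h3.fderiv]
  simp only [pderiv, ContinuousLinearMap.comp_apply, ContinuousLinearMap.prod_apply,
    add_apply, smul_apply,
    ContinuousLinearMap.smulRight_apply, Function.comp_apply, smul_eq_mul]
  congr 2
  rw [add_comm, mul_comm]

end Splitting

/-- A profile: the radius `r` (as a function of the polar angle) of a rotation hypersurface of the
sphere with constant second mean curvature `H`, with its first-order data: the derivative `v` of `r`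
with respect to arc length, the function `w = √(1 - r² - v²)`, and the rate `κ` of change of `w`
with respect to `r`. -/
structure Profile (n : ℕ) (H : ℝ) where
  r : ℝ → ℝ
  w : ℝ → ℝ
  v : ℝ → ℝ
  κ : ℝ → ℝ
  contDiff_r : ContDiff ℝ ∞ r
  periodic_r : Function.Periodic r (2 * Real.pi)
  r_pos : ∀ θ, 0 < r θ
  w_pos : ∀ θ, 0 < w θ
  sq_add_sq : ∀ θ, r θ ^ 2 + w θ ^ 2 + v θ ^ 2 = 1
  hasDerivAt_r : ∀ θ, HasDerivAt r ((1 - r θ ^ 2) / w θ * v θ) θ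
  hasDerivAt_w : ∀ θ, HasDerivAt w ((1 - r θ ^ 2) / w θ * (κ θ * v θ)) θ
  hasDerivAt_v : ∀ θ, HasDerivAt v ((1 - r θ ^ 2) / w θ * (- r θ - κ θ * w θ)) θ
  mean_eq : ∀ θ, n * H * r θ ^ 2 = 2 * w θ * κ θ * r θ + (n - 2) * w θ ^ 2
  nonconst : ∃ θ₁ θ₂, (H - (w θ₁ / r θ₁) ^ 2) ^ 2 ≠ (H - (w θ₂ / r θ₂) ^ 2) ^ 2

namespace Profile

variable {n : ℕ} {H : ℝ} (P : Profile n H)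

/-- The norm of the planar part of the points with angle `θ`. -/
noncomputable def c (θ : ℝ) : ℝ := √(1 - P.r θ ^ 2)

lemma one_sub_pos (θ : ℝ) : 0 < 1 - P.r θ ^ 2 := by
  have := P.sq_add_sq θ
  have := P.w_pos θ
  nlinarith [sq_nonneg (P.v θ)]

lemma c_pos (θ : ℝ) : 0 < P.c θ := Real.sqrt_pos.2 (P.one_sub_pos θ)

lemma c_sq (θ : ℝ) : P.c θ ^ 2 = 1 - P.r θ ^ 2 := Real.sq_sqrt (P.one_sub_pos θ).le

lemma contDiff_c : ContDiff ℝ ∞ P.c :=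
  (contDiff_const.sub (P.contDiff_r.pow 2)).sqrt fun θ => (P.one_sub_pos θ).ne'

/-- The point of the rotation hypersurface with angle `θ` and direction `η`. -/
noncomputable def point (θ : ℝ) (η : E n) : E (n + 2) :=
  join ((P.c θ : ℂ) * Complex.exp (θ * Complex.I), P.r θ • η)

/-- The rotation hypersurface with the given profile. -/
def surface : Set (E (n + 2)) := {p | ∃ (θ : ℝ) (η : E n), ‖η‖ = 1 ∧ p = P.point θ η}

lemma contDiff_point : ContDiff ℝ ∞ fun q : ℝ × E n => P.point q.1 q.2 := by
  unfold point
  refine join.contDiff.comp (ContDiff.prodMk ?_ ?_)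
  · refine (Complex.ofRealCLM.contDiff.comp (P.contDiff_c.comp contDiff_fst)).mul ?_
    refine ContDiff.cexp ?_
    exact (Complex.ofRealCLM.contDiff.comp contDiff_fst).mul contDiff_const
  · exact (P.contDiff_r.comp contDiff_fst).smul contDiff_snd

lemma norm_point (θ : ℝ) {η : E n} (hη : ‖η‖ = 1) : ‖P.point θ η‖ = 1 := by
  have h : ‖P.point θ η‖ ^ 2 = 1 := by
    rw [← real_inner_self_eq_norm_sq, point, inner_join_mul_exp, inner_smul_left, inner_smul_right,
      real_inner_self_eq_norm_sq, hη]
    simp only [Complex.ofReal_re, Complex.ofReal_im, conj_trivial]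
    linear_combination P.c_sq θ
  exact (pow_eq_one_iff_of_nonneg (norm_nonneg _) two_ne_zero).1 h

lemma point_eq_of_fstPart {p : E (n + 2)} (hp : p ∈ P.surface) {ρ θ : ℝ} (hρ : 0 < ρ)
    (hθ : fstPart p = ρ * Complex.exp (θ * Complex.I)) :
    ‖sndPart p‖ = P.r θ ∧ p = P.point θ ((P.r θ)⁻¹ • sndPart p) := by
  obtain ⟨θ', η, hη, rfl⟩ := hp
  simp only [point, fstPart_join, sndPart_join] at hθ ⊢
  have hn := congrArg (fun z : ℂ => ‖z‖) hθ
  simp only [norm_mul, Complex.norm_exp_ofReal_mul_I, mul_one, Complex.norm_real, Real.norm_eq_abs,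
    abs_of_pos hρ, abs_of_pos (P.c_pos θ')] at hn
  rw [hn] at hθ
  have he := mul_left_cancel₀ (Complex.ofReal_ne_zero.2 hρ.ne') hθ
  obtain ⟨m, hm⟩ := Complex.exp_eq_exp_iff_exists_int.1 he
  have hm' : θ' = θ + m * (2 * Real.pi) := by
    have := congrArg Complex.im hm
    simpa using this
  have hr : P.r θ' = P.r θ := by rw [hm', P.periodic_r.int_mul m θ]
  have hc : P.c θ' = P.c θ := by rw [c, c, hr]
  refine ⟨by rw [norm_smul, hη, Real.norm_eq_abs, abs_of_pos (P.r_pos θ'), hr, mul_one], ?_⟩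
  rw [he, hr, hc, smul_smul, smul_smul, mul_assoc, inv_mul_cancel₀ (P.r_pos θ).ne', mul_one]

lemma surface_eq_image : P.surface =
    (fun q : ℝ × E n => P.point q.1 q.2) ''
      (Set.Icc 0 (2 * Real.pi) ×ˢ Metric.sphere (0 : E n) 1) := by
  ext p
  constructor
  · rintro ⟨θ, η, hη, rfl⟩
    obtain ⟨y, hy, hy'⟩ := (Function.Periodic.exists_mem_Ico₀ (f := fun θ =>
      ((P.c θ : ℂ) * Complex.exp (θ * Complex.I), P.r θ)) (c := 2 * Real.pi) (fun x => by
        simp only [c, P.periodic_r x]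
        congr 2
        push_cast
        rw [add_mul, Complex.exp_periodic]) Real.two_pi_pos θ)
    refine ⟨(y, η), ⟨⟨hy.1, hy.2.le⟩, by simpa using hη⟩, ?_⟩
    simp only [Prod.mk.injEq] at hy'
    simp only [point, hy'.1, hy'.2]
  · rintro ⟨⟨θ, η⟩, ⟨-, hη⟩, rfl⟩
    exact ⟨θ, η, by simpa using hη, rfl⟩

/-! ### The hypersurface is embedded -/

/-- The polar angle, near the angle `θ₀`. -/
noncomputable def angle (θ₀ : ℝ) (p : E (n + 2)) : ℝ :=
  θ₀ + (fstPart p * Complex.exp ((-θ₀ : ℝ) * Complex.I)).arg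

/-- The half space of points whose polar angle is less than `π / 2` away from `θ₀`. -/
def halfSpace (n : ℕ) (θ₀ : ℝ) : Set (E (n + 2)) :=
  {p | 0 < (fstPart p * Complex.exp ((-θ₀ : ℝ) * Complex.I)).re}

lemma isOpen_halfSpace (θ₀ : ℝ) : IsOpen (halfSpace n θ₀) :=
  isOpen_lt continuous_const (Complex.continuous_re.comp (fstPart.continuous.mul continuous_const))

lemma contDiffAt_angle {θ₀ : ℝ} {p : E (n + 2)} (hp : p ∈ halfSpace n θ₀) :
    ContDiffAt ℝ ∞ (angle (n := n) θ₀) p := by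
  have h1 : ContDiffAt ℝ ∞ Complex.log (fstPart p * Complex.exp ((-θ₀ : ℝ) * Complex.I)) :=
    (Complex.contDiffAt_log (Complex.mem_slitPlane_iff.2 (Or.inl hp))).restrict_scalars ℝ
  have h2 : ContDiffAt ℝ ∞ (fun p : E (n + 2) =>
      fstPart p * Complex.exp ((-θ₀ : ℝ) * Complex.I)) p :=
    fstPart.contDiff.contDiffAt.mul contDiffAt_const
  have h3 : ContDiffAt ℝ ∞ (fun p : E (n + 2) =>
      Complex.imCLM (Complex.log (fstPart p * Complex.exp ((-θ₀ : ℝ) * Complex.I)))) p :=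
    Complex.imCLM.contDiff.contDiffAt.comp p (ContDiffAt.comp (g := Complex.log) p h1 h2)
  simp only [Complex.imCLM_apply, Complex.log_im] at h3
  exact contDiffAt_const.add h3

lemma fstPart_eq_angle (θ₀ : ℝ) (p : E (n + 2)) :
    fstPart p = ‖fstPart p‖ * Complex.exp (angle θ₀ p * Complex.I) := by
  have h := Complex.norm_mul_exp_arg_mul_I (fstPart p * Complex.exp ((-θ₀ : ℝ) * Complex.I))
  rw [norm_mul, Complex.norm_exp_ofReal_mul_I, mul_one] at h
  rw [angle, Complex.ofReal_add, add_mul, Complex.exp_add, mul_left_comm, h, mul_left_comm,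
    ← Complex.exp_add]
  simp

lemma fstPart_point_mul (θ₀ t : ℝ) (η : E n) :
    fstPart (P.point (θ₀ + t) η) * Complex.exp ((-θ₀ : ℝ) * Complex.I) =
      P.c (θ₀ + t) * Complex.exp (t * Complex.I) := by
  rw [point, fstPart_join, mul_assoc, ← Complex.exp_add]
  congr 2
  push_cast
  ring

lemma point_mem_halfSpace {θ₀ t : ℝ} (ht : |t| < Real.pi / 2) (η : E n) :
    P.point (θ₀ + t) η ∈ halfSpace n θ₀ := by
  rw [halfSpace, Set.mem_ofPred_eq, fstPart_point_mul, Complex.re_ofReal_mul,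
    Complex.exp_ofReal_mul_I_re]
  exact mul_pos (P.c_pos _) (Real.cos_pos_of_mem_Ioo (abs_lt.1 ht))

lemma angle_point {θ₀ t : ℝ} (ht : |t| < Real.pi / 2) (η : E n) :
    angle θ₀ (P.point (θ₀ + t) η) = θ₀ + t := by
  have ht' := abs_lt.1 ht
  rw [angle, fstPart_point_mul, Complex.arg_real_mul _ (P.c_pos _), Complex.arg_exp_mul_I,
    (toIocMod_eq_self _).2]
  constructor <;> linarith [Real.pi_pos, ht'.1, ht'.2]

lemma surface_eq_point_angle {p : E (n + 2)} (hp : p ∈ P.surface) (θ₀ : ℝ) :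
    ‖sndPart p‖ = P.r (angle θ₀ p) ∧
      p = P.point (angle θ₀ p) ((P.r (angle θ₀ p))⁻¹ • sndPart p) := by
  refine P.point_eq_of_fstPart hp (ρ := ‖fstPart p‖) ?_ (fstPart_eq_angle θ₀ p)
  obtain ⟨θ', η, hη, rfl⟩ := hp
  rw [point, fstPart_join, norm_mul, Complex.norm_exp_ofReal_mul_I, mul_one, Complex.norm_real]
  exact norm_pos_iff.2 (P.c_pos θ').ne'

/-- The chart around the point with angle `θ₀` and direction `η₀`: the coordinate along `η₀` moves
the angle, the coordinates orthogonal to `η₀` are central projection coordinates of the direction.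
-/
noncomputable def chart (θ₀ : ℝ) (η₀ : E n) (x : E n) : E (n + 2) :=
  P.point (θ₀ + ⟪η₀, x⟫_ℝ) (‖η₀ + x - ⟪η₀, x⟫_ℝ • η₀‖⁻¹ • (η₀ + x - ⟪η₀, x⟫_ℝ • η₀))

/-- The inverse of the chart around the point with angle `θ₀` and direction `η₀`. -/
noncomputable def chartInv (θ₀ : ℝ) (η₀ : E n) (p : E (n + 2)) : E n :=
  (angle θ₀ p - θ₀) • η₀ + ((⟪η₀, sndPart p⟫_ℝ)⁻¹ • sndPart p - η₀)

/-- The domain of the chart. -/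
def chartSource (η₀ : E n) : Set (E n) := {x | |⟪η₀, x⟫_ℝ| < Real.pi / 2}

/-- The open set whose intersection with the hypersurface is the image of the chart. -/
def chartTarget (θ₀ : ℝ) (η₀ : E n) : Set (E (n + 2)) :=
  halfSpace n θ₀ ∩ {p | 0 < ⟪η₀, sndPart p⟫_ℝ}

variable {η₀ : E n}

lemma isOpen_chartTarget (θ₀ : ℝ) (η₀ : E n) : IsOpen (chartTarget θ₀ η₀) :=
  (isOpen_halfSpace θ₀).inter
    (isOpen_lt continuous_const (continuous_const.inner sndPart.continuous))

lemma contDiffOn_chartInv (θ₀ : ℝ) (η₀ : E n) :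
    ContDiffOn ℝ ∞ (chartInv θ₀ η₀) (chartTarget θ₀ η₀) := by
  intro p hp
  refine ContDiffAt.contDiffWithinAt ?_
  unfold chartInv
  have h1 : ContDiffAt ℝ ∞ (fun p : E (n + 2) => ⟪η₀, sndPart p⟫_ℝ) p :=
    (contDiff_const.inner ℝ sndPart.contDiff).contDiffAt
  have h2 : ContDiffAt ℝ ∞ (fun p : E (n + 2) => (⟪η₀, sndPart p⟫_ℝ)⁻¹) p :=
    h1.inv (ne_of_gt hp.2)
  have h3 : ContDiffAt ℝ ∞ (fun p : E (n + 2) => angle θ₀ p - θ₀) p :=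
    (contDiffAt_angle hp.1).sub contDiffAt_const
  exact (h3.smul contDiffAt_const).add
    ((h2.smul sndPart.contDiff.contDiffAt).sub contDiffAt_const)

lemma inner_direction (hη₀ : ‖η₀‖ = 1) (x : E n) : ⟪η₀, η₀ + x - ⟪η₀, x⟫_ℝ • η₀⟫_ℝ = 1 := by
  rw [inner_sub_right, inner_add_right, inner_smul_right, real_inner_self_eq_norm_sq, hη₀]
  ring

lemma direction_ne_zero (hη₀ : ‖η₀‖ = 1) (x : E n) : η₀ + x - ⟪η₀, x⟫_ℝ • η₀ ≠ 0 := fun h => by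
  have := inner_direction hη₀ x
  rw [h, inner_zero_right] at this
  exact zero_ne_one this

lemma contDiff_chart (hη₀ : ‖η₀‖ = 1) (θ₀ : ℝ) : ContDiff ℝ ∞ (P.chart θ₀ η₀) := by
  have h1 : ContDiff ℝ ∞ fun x : E n => ⟪η₀, x⟫_ℝ := contDiff_const.inner ℝ contDiff_id
  have h2 : ContDiff ℝ ∞ fun x : E n => η₀ + x - ⟪η₀, x⟫_ℝ • η₀ :=
    (contDiff_const.add contDiff_id).sub (h1.smul contDiff_const)
  have h3 : ContDiff ℝ ∞ fun x : E n => ‖η₀ + x - ⟪η₀, x⟫_ℝ • η₀‖⁻¹ :=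
    ContDiff.inv (h2.norm ℝ (direction_ne_zero hη₀)) fun x =>
      norm_ne_zero_iff.2 (direction_ne_zero hη₀ x)
  have h4 : ContDiff ℝ ∞ fun x : E n => θ₀ + ⟪η₀, x⟫_ℝ := contDiff_const.add h1
  have h5 : ContDiff ℝ ∞ fun x : E n =>
      ‖η₀ + x - ⟪η₀, x⟫_ℝ • η₀‖⁻¹ • (η₀ + x - ⟪η₀, x⟫_ℝ • η₀) := h3.smul h2
  have h6 := P.contDiff_point.comp (h4.prodMk h5)
  exact h6

lemma chart_mem (hη₀ : ‖η₀‖ = 1) (θ₀ : ℝ) {x : E n} (hx : x ∈ chartSource η₀) :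
    P.chart θ₀ η₀ x ∈ P.surface ∩ chartTarget θ₀ η₀ := by
  have hd := norm_pos_iff.2 (direction_ne_zero hη₀ x)
  refine ⟨⟨_, _, ?_, rfl⟩, P.point_mem_halfSpace hx _, ?_⟩
  · rw [norm_smul, norm_inv, norm_norm, inv_mul_cancel₀ hd.ne']
  · rw [Set.mem_ofPred_eq, chart, point, sndPart_join, inner_smul_right, inner_smul_right,
      inner_direction hη₀, mul_one]
    exact mul_pos (P.r_pos _) (inv_pos.2 hd)

lemma chartInv_chart (hη₀ : ‖η₀‖ = 1) (θ₀ : ℝ) {x : E n} (hx : x ∈ chartSource η₀) :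
    chartInv θ₀ η₀ (P.chart θ₀ η₀ x) = x := by
  have hd := norm_pos_iff.2 (direction_ne_zero hη₀ x)
  rw [chartInv, chart, P.angle_point hx, point, sndPart_join, inner_smul_right, inner_smul_right,
      inner_direction hη₀, mul_one, smul_smul, smul_smul, mul_assoc, inv_mul_cancel₀
      (mul_pos (P.r_pos _) (inv_pos.2 hd)).ne', one_smul, add_sub_cancel_left]
  abel

lemma chart_chartInv (hη₀ : ‖η₀‖ = 1) (θ₀ : ℝ) {p : E (n + 2)} (hp : p ∈ P.surface ∩ chartTarget θ₀ η₀) :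
    chartInv θ₀ η₀ p ∈ chartSource η₀ ∧ P.chart θ₀ η₀ (chartInv θ₀ η₀ p) = p := by
  obtain ⟨h1, h2⟩ := P.surface_eq_point_angle hp.1 θ₀
  have hpos : 0 < ⟪η₀, sndPart p⟫_ℝ := hp.2.2
  have hin : ⟪η₀, chartInv θ₀ η₀ p⟫_ℝ = angle θ₀ p - θ₀ := by
    rw [chartInv, inner_add_right, inner_sub_right, inner_smul_right, inner_smul_right,
      real_inner_self_eq_norm_sq, hη₀, inv_mul_cancel₀ hpos.ne']
    ring
  constructor
  · rw [chartSource, Set.mem_ofPred_eq, hin, angle, add_sub_cancel_left]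
    exact Complex.abs_arg_lt_pi_div_two_iff.2 (Or.inl hp.2.1)
  · have hdir : η₀ + chartInv θ₀ η₀ p - (angle θ₀ p - θ₀) • η₀ =
        (⟪η₀, sndPart p⟫_ℝ)⁻¹ • sndPart p := by
      rw [chartInv]
      abel
    rw [chart, hin, hdir, add_sub_cancel, norm_smul, smul_smul, norm_inv, Real.norm_eq_abs,
      abs_of_pos hpos, mul_inv, inv_inv, mul_right_comm, mul_inv_cancel₀ hpos.ne', one_mul, h1]
    exact h2.symm

lemma isLocalParam_chart (hη₀ : ‖η₀‖ = 1) (θ₀ : ℝ) : IsLocalParam P.surface (chartSource η₀) (P.chart θ₀ η₀) := by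
  have hsm := P.contDiff_chart hη₀ θ₀
  have hU : IsOpen (chartSource η₀) :=
    isOpen_lt (continuous_const.inner continuous_id).abs continuous_const
  refine ⟨hU, hsm.contDiffOn, fun x hx => ?_, ?_, chartTarget θ₀ η₀, isOpen_chartTarget θ₀ η₀, ?_⟩
  · have h1 : DifferentiableAt ℝ (chartInv θ₀ η₀) (P.chart θ₀ η₀ x) :=
      ((contDiffOn_chartInv θ₀ η₀).contDiffAt ((isOpen_chartTarget θ₀ η₀).mem_nhds
        (P.chart_mem hη₀ θ₀ hx).2)).differentiableAt (by simp)
    have h2 : DifferentiableAt ℝ (P.chart θ₀ η₀) x := hsm.contDiffAt.differentiableAt (by simp)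
    have h3 := h1.hasFDerivAt.comp x h2.hasFDerivAt
    have h4 : HasFDerivAt (chartInv θ₀ η₀ ∘ P.chart θ₀ η₀) (ContinuousLinearMap.id ℝ (E n)) x :=
      (hasFDerivAt_id x).congr_of_eventuallyEq (Filter.eventuallyEq_of_mem (hU.mem_nhds hx)
        fun y hy => P.chartInv_chart hη₀ θ₀ hy)
    have h5 := h3.unique h4
    intro a b hab
    have := congrArg (fderiv ℝ (chartInv θ₀ η₀) (P.chart θ₀ η₀ x)) hab
    rw [← ContinuousLinearMap.comp_apply, ← ContinuousLinearMap.comp_apply, h5] at this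
    simpa using this
  · have hF : Continuous fun x : chartSource η₀ =>
        (⟨P.chart θ₀ η₀ x, (P.chart_mem hη₀ θ₀ x.2).2⟩ : chartTarget θ₀ η₀) :=
      Continuous.subtype_mk (hsm.continuous.comp continuous_subtype_val) _
    have hG : Continuous fun p : chartTarget θ₀ η₀ => chartInv θ₀ η₀ p :=
      continuousOn_iff_continuous_domRestrict.1 (contDiffOn_chartInv θ₀ η₀).continuousOn
    have hGF : Topology.IsEmbedding ((fun p : chartTarget θ₀ η₀ => chartInv θ₀ η₀ p) ∘
        fun x : chartSource η₀ =>
        (⟨P.chart θ₀ η₀ x, (P.chart_mem hη₀ θ₀ x.2).2⟩ : chartTarget θ₀ η₀)) := by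
      have : ((fun p : chartTarget θ₀ η₀ => chartInv θ₀ η₀ p) ∘ fun x : chartSource η₀ =>
          (⟨P.chart θ₀ η₀ x, (P.chart_mem hη₀ θ₀ x.2).2⟩ : chartTarget θ₀ η₀)) = Subtype.val :=
        funext fun x => P.chartInv_chart hη₀ θ₀ x.2
      rw [this]
      exact Topology.IsEmbedding.subtypeVal
    exact Topology.IsEmbedding.subtypeVal.comp (Topology.IsEmbedding.of_comp hF hG hGF)
  · ext p
    constructor
    · rintro ⟨x, hx, rfl⟩
      exact P.chart_mem hη₀ θ₀ hx
    · intro hp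
      exact ⟨_, (P.chart_chartInv hη₀ θ₀ hp).1, (P.chart_chartInv hη₀ θ₀ hp).2⟩

lemma point_mem_chart (hη₀ : ‖η₀‖ = 1) (θ₀ : ℝ) : (0 : E n) ∈ chartSource η₀ ∧ P.chart θ₀ η₀ 0 = P.point θ₀ η₀ := by
  constructor
  · simp [chartSource, Real.pi_pos]
  · simp [chart, hη₀]

lemma isCompactEmbeddedHypersurface (hn : 2 ≤ n) :
    IsCompactEmbeddedHypersurface n P.surface := by
  have hcont : Continuous fun q : ℝ × E n => P.point q.1 q.2 := P.contDiff_point.continuous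
  refine ⟨?_, ?_, ?_, ?_⟩
  · rintro _ ⟨θ, η, hη, rfl⟩
    simpa using P.norm_point θ hη
  · rintro _ ⟨θ, η, hη, rfl⟩
    exact ⟨_, _, P.isLocalParam_chart hη θ, 0, P.point_mem_chart hη θ⟩
  · rw [surface_eq_image]
    exact (isCompact_Icc.prod (isCompact_sphere _ _)).image hcont
  · rw [surface_eq_image]
    refine IsConnected.image (IsConnected.prod (isConnected_Icc Real.two_pi_pos.le)
      (isConnected_sphere ?_ 0 zero_le_one)) _ hcont.continuousOn
    rw [← Module.finrank_eq_rank, finrank_euclideanSpace_fin]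
    exact_mod_cast hn

end Profile

lemma hasDerivAt_rotating {a b : ℝ → ℝ} {a' b' θ : ℝ} (ha : HasDerivAt a a' θ)
    (hb : HasDerivAt b b' θ) :
    HasDerivAt (fun θ : ℝ => (⟨a θ, b θ⟩ : ℂ) * Complex.exp (θ * Complex.I))
      ((⟨a' - b θ, b' + a θ⟩ : ℂ) * Complex.exp (θ * Complex.I)) θ := by
  have h1 : HasDerivAt (fun θ : ℝ => (a θ : ℂ) + b θ * Complex.I) (a' + b' * Complex.I) θ :=
    ha.ofReal_comp.add (hb.ofReal_comp.mul_const _)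
  have h2 : HasDerivAt (fun θ : ℝ => Complex.exp (θ * Complex.I))
      (Complex.exp (θ * Complex.I) * (1 * Complex.I)) θ :=
    ((hasDerivAt_id θ).ofReal_comp.mul_const Complex.I).cexp
  simp only [Complex.mk_eq_add_mul_I]
  refine (h1.mul h2).congr_deriv ?_
  push_cast
  linear_combination ((b θ : ℂ) * Complex.exp (θ * Complex.I)) * Complex.I_sq

/-- Unit normals of a hypersurface of the sphere are unique up to sign. -/
lemma eq_or_eq_neg_of_isUnitNormal {n : ℕ} {f : E n → E (n + 2)} {u : E n}
    (himm : Function.Injective (fderiv ℝ f u)) (hs : ‖f u‖ = 1)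
    (hs' : ∀ i, ⟪f u, pderiv i f u⟫_ℝ = 0) {ν ν' : E (n + 2)} (hν : IsUnitNormal f u ν)
    (hν' : IsUnitNormal f u ν') : ν' = ν ∨ ν' = -ν := by
  have h1 : ν' = ⟪ν', ν⟫_ℝ • ν := by
    refine ext_inner_left ℝ fun a => ?_
    rw [inner_eq_frame himm hs hs' hν a ν', inner_smul_right, real_inner_comm (f u) ν',
      hν'.tangent_sphere]
    have : ∀ i, ⟪ν', pderiv i f u⟫_ℝ = 0 := fun i => by rw [real_inner_comm, hν'.normal]
    simp only [this, mul_zero, Finset.sum_const_zero, zero_add]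
    ring
  have h2 := congrArg (fun x => ‖x‖) h1
  simp only [norm_smul, hν.norm_eq_one, hν'.norm_eq_one, mul_one, Real.norm_eq_abs] at h2
  rcases eq_or_eq_neg_of_abs_eq h2.symm with h | h <;> rw [h] at h1
  · exact Or.inl (by rw [h1, one_smul])
  · exact Or.inr (by rw [h1, neg_smul, one_smul])

namespace Profile

variable {n : ℕ} {H : ℝ} (P : Profile n H)

/-- The rate of change of arc length with respect to the angle. -/
noncomputable def speed (θ : ℝ) : ℝ := (1 - P.r θ ^ 2) / P.w θ

/-- The planar part, in the rotating frame, of the unit tangent of the profile curve. -/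
noncomputable def tangentPart (θ : ℝ) : ℂ := ⟨-(P.r θ * P.v θ) / P.c θ, P.w θ / P.c θ⟩

/-- The planar part, in the rotating frame, of the unit normal of the hypersurface. -/
noncomputable def normalPart (θ : ℝ) : ℂ := ⟨-(P.r θ * P.w θ) / P.c θ, -P.v θ / P.c θ⟩

/-- The unit tangent vector along the profile curves. -/
noncomputable def tangent (θ : ℝ) (η : E n) : E (n + 2) :=
  join (P.tangentPart θ * Complex.exp (θ * Complex.I), P.v θ • η)

/-- The unit normal of the hypersurface. -/
noncomputable def normal (θ : ℝ) (η : E n) : E (n + 2) :=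
  join (P.normalPart θ * Complex.exp (θ * Complex.I), P.w θ • η)

lemma hasDerivAt_c (θ : ℝ) : HasDerivAt P.c (-(P.speed θ * (P.r θ * P.v θ) / P.c θ)) θ := by
  have h := (((P.hasDerivAt_r θ).pow 2).const_sub 1).sqrt (P.one_sub_pos θ).ne'
  refine h.congr_deriv ?_
  change _ / (2 * P.c θ) = _
  have := (P.c_pos θ).ne'
  simp only [speed]
  field_simp
  ring

lemma hasDerivAt_pointPart (θ : ℝ) :
    HasDerivAt (fun θ : ℝ => (P.c θ : ℂ) * Complex.exp (θ * Complex.I))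
      (P.speed θ • (P.tangentPart θ * Complex.exp (θ * Complex.I))) θ := by
  have h := hasDerivAt_rotating (P.hasDerivAt_c θ) (hasDerivAt_const θ (0 : ℝ))
  have hc := (P.c_pos θ).ne'
  have hw := (P.w_pos θ).ne'
  refine h.congr_deriv ?_
  rw [← smul_mul_assoc]
  congr 1
  apply Complex.ext
  · simp [tangentPart]
    ring
  · simp only [zero_add, tangentPart, speed, ← P.c_sq, Complex.smul_im, smul_eq_mul]
    field_simp

lemma hasDerivAt_normalPart (θ : ℝ) :
    HasDerivAt (fun θ : ℝ => P.normalPart θ * Complex.exp (θ * Complex.I))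
      ((P.speed θ * P.κ θ) • (P.tangentPart θ * Complex.exp (θ * Complex.I))) θ := by
  have hc := (P.c_pos θ).ne'
  have hw := (P.w_pos θ).ne'
  have hc2 := P.c_sq θ
  have hs := P.sq_add_sq θ
  have h := hasDerivAt_rotating
    ((((P.hasDerivAt_r θ).mul (P.hasDerivAt_w θ)).neg).div (P.hasDerivAt_c θ) hc)
    ((P.hasDerivAt_v θ).neg.div (P.hasDerivAt_c θ) hc)
  refine h.congr_deriv ?_
  rw [← smul_mul_assoc]
  congr 1
  apply Complex.ext
  · simp only [tangentPart, speed, Complex.smul_re, smul_eq_mul, Pi.neg_apply, Pi.mul_apply, Pi.div_apply,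
      ← hc2]
    field_simp
    linear_combination -(P.v θ * P.w θ) * hc2
  · simp only [tangentPart, speed, Complex.smul_im, smul_eq_mul, Pi.neg_apply, Pi.mul_apply, Pi.div_apply,
      ← hc2]
    field_simp
    linear_combination P.r θ * (hc2 - hs)

lemma frame_inner (θ : ℝ) {η : E n} (hη : ‖η‖ = 1) :
    ⟪P.tangent θ η, P.tangent θ η⟫_ℝ = 1 ∧ ⟪P.normal θ η, P.normal θ η⟫_ℝ = 1 ∧
    ⟪P.tangent θ η, P.normal θ η⟫_ℝ = 0 ∧ ⟪P.point θ η, P.normal θ η⟫_ℝ = 0 ∧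
    ⟪P.tangent θ η, P.point θ η⟫_ℝ = 0 := by
  have hc := (P.c_pos θ).ne'
  have hc2 := P.c_sq θ
  have hs := P.sq_add_sq θ
  have hηη : ⟪η, η⟫_ℝ = 1 := by rw [real_inner_self_eq_norm_sq, hη, one_pow]
  simp only [tangent, normal, point, inner_join_mul_exp, inner_smul_left, inner_smul_right, hηη,
    tangentPart, normalPart, Complex.ofReal_re, Complex.ofReal_im, conj_trivial]
  refine ⟨?_, ?_, ?_, ?_, ?_⟩ <;> field_simp
  · linear_combination (P.v θ ^ 2 - 1) * hc2 + hs
  · linear_combination (P.w θ ^ 2 - 1) * hc2 + hs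
  · linear_combination (P.v θ * P.w θ) * hc2
  · ring
  · ring

/-- The second fundamental form of the rotation hypersurface. -/
lemma exists_secondForm {U : Set (E n)} {f : E n → E (n + 2)} (hf : IsLocalParam P.surface U f)
    {u : E n} (hu : u ∈ U) {θ₀ : ℝ} {η₀ : E n} (hη₀ : ‖η₀‖ = 1) (hfu : f u = P.point θ₀ η₀) :
    ∃ (ν : E (n + 2)) (y : Fin n → ℝ), IsUnitNormal f u ν ∧
      secondForm f ν u = (-(P.w θ₀ / P.r θ₀)) • metric f u
        + (-(P.κ θ₀ - P.w θ₀ / P.r θ₀)) • Matrix.vecMulVec y y ∧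
      ((metric f u)⁻¹ *ᵥ y) ⬝ᵥ y = 1 := by
  have hsurf : ∀ x ∈ U, f x ∈ P.surface := fun x hx => by
    obtain ⟨V, -, hV⟩ := hf.image_open
    exact (hV ▸ Set.mem_image_of_mem f hx : f x ∈ P.surface ∩ V).1
  have hs : ∀ x ∈ U, ‖f x‖ = 1 := fun x hx => by
    obtain ⟨θ, η, hη, h⟩ := hsurf x hx
    rw [h, P.norm_point θ hη]
  set W := U ∩ f ⁻¹' halfSpace n θ₀ with hW
  have hWo : IsOpen W := hf.contDiffOn.continuousOn.isOpen_inter_preimage hf.isOpen_source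
    (isOpen_halfSpace θ₀)
  have hsm : ContDiffOn ℝ ∞ f W := hf.contDiffOn.mono Set.inter_subset_left
  have hpi2 : |(0 : ℝ)| < Real.pi / 2 := by simp [Real.pi_pos]
  have huW : u ∈ W := by
    refine ⟨hu, ?_⟩
    rw [Set.mem_preimage, hfu]
    have := P.point_mem_halfSpace (θ₀ := θ₀) hpi2 η₀
    rwa [add_zero] at this
  set θ : E n → ℝ := fun x => angle θ₀ (f x) with hθ
  set η : E n → E n := fun x => (P.r (θ x))⁻¹ • sndPart (f x) with hη
  have hθu : θ u = θ₀ := by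
    have := P.angle_point (θ₀ := θ₀) hpi2 η₀
    rw [add_zero] at this
    simp only [hθ, hfu, this]
  have hfx : ∀ x ∈ W, f x = P.point (θ x) (η x) := fun x hx =>
    (P.surface_eq_point_angle (hsurf x hx.1) θ₀).2
  have hηx : ∀ x ∈ W, ‖η x‖ = 1 := fun x hx => by
    rw [hη, norm_smul, (P.surface_eq_point_angle (hsurf x hx.1) θ₀).1, norm_inv, Real.norm_eq_abs,
      abs_of_pos (P.r_pos _), inv_mul_cancel₀ (P.r_pos _).ne']
  have hdf : ∀ x ∈ W, DifferentiableAt ℝ f x := fun x hx => differentiableAt_of_contDiffOn hWo hsm hx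
  have hdθ : ∀ x ∈ W, DifferentiableAt ℝ θ x := fun x hx =>
    ((contDiffAt_angle hx.2).differentiableAt (by simp)).comp x (hdf x hx)
  have hdη : ∀ x ∈ W, DifferentiableAt ℝ η x := fun x hx => by
    have h1 : DifferentiableAt ℝ (fun x => P.r (θ x)) x :=
      ((P.hasDerivAt_r (θ x)).differentiableAt).comp x (hdθ x hx)
    exact (h1.fun_inv (P.r_pos _).ne').smul ((sndPart.differentiableAt).comp x (hdf x hx))
  have hηη : ∀ x ∈ W, ∀ i, ⟪η x, pderiv i η x⟫_ℝ = 0 := fun x hx i => by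
    have := pderiv_inner (hdη x hx) (hdη x hx) i
    rw [pderiv_eq_zero_of_const hWo (c := 1)
      (fun v hv => by rw [real_inner_self_eq_norm_sq, hηx v hv, one_pow]) i hx,
      real_inner_comm (η x)] at this
    linarith
  have hfi : ∀ x ∈ W, ∀ i, pderiv i f x = (pderiv i θ x * P.speed (θ x)) • P.tangent (θ x) (η x)
      + join (0, P.r (θ x) • pderiv i η x) := fun x hx i => by
    rw [pderiv_congr_of_eqOn hWo hfx i hx]
    unfold point
    rw [(pderiv_join (P.hasDerivAt_pointPart (θ x)) (P.hasDerivAt_r (θ x)) (hdθ x hx)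
      (hdη x hx) i).2, tangent, ← map_smul, ← map_add]
    congr 1
    refine Prod.ext ?_ ?_
    · simp [mul_assoc]
    · simp [speed, smul_smul, mul_assoc]
  have hN := pderiv_join (P.hasDerivAt_normalPart (θ u)) (P.hasDerivAt_w (θ u)) (hdθ u huW)
      (hdη u huW)
  set ν : E n → E (n + 2) := fun x => P.normal (θ x) (η x) with hν
  have hdν : DifferentiableAt ℝ ν u := by
    rw [hν]
    unfold normal
    rcases n with _ | n
    · exact (hasFDerivAt_of_subsingleton _ u).differentiableAt
    · exact (hN 0).1
  have hνi : ∀ i, pderiv i ν u = (P.w (θ u) / P.r (θ u)) • pderiv i f u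
      + ((P.κ (θ u) - P.w (θ u) / P.r (θ u)) * (pderiv i θ u * P.speed (θ u)))
        • P.tangent (θ u) (η u) := fun i => by
    rw [hν]
    unfold normal
    rw [(hN i).2, hfi u huW i, tangent, ← map_smul, ← map_smul, ← map_add, ← map_smul, ← map_add]
    congr 1
    have hr := (P.r_pos (θ u)).ne'
    refine Prod.ext ?_ ?_
    · simp only [Prod.fst_add, Prod.smul_fst, add_zero, smul_smul, ← add_smul]
      congr 1
      ring
    · simp only [Prod.snd_add, Prod.smul_snd, smul_add, smul_smul]
      rw [div_mul_cancel₀ _ hr]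
      rw [add_right_comm, ← add_smul, speed]
      congr 2
      ring
  have hjoin : ∀ x ∈ W, ∀ i (a : ℂ) (b : ℝ),
      ⟪join (a, b • η x), join (0, P.r (θ x) • pderiv i η x)⟫_ℝ = 0 := fun x hx i a b => by
    rw [inner_join, inner_smul_left, inner_smul_right, hηη x hx]
    simp
  have hft : ∀ x ∈ W, ∀ i, ⟪P.tangent (θ x) (η x), pderiv i f x⟫_ℝ
      = pderiv i θ x * P.speed (θ x) := fun x hx i => by
    rw [hfi x hx, inner_add_right, inner_smul_right, (P.frame_inner (θ x) (hηx x hx)).1, tangent,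
      hjoin x hx, mul_one, add_zero]
  have hfν : ∀ i, ∀ x ∈ W, ⟪pderiv i f x, ν x⟫_ℝ = 0 := fun i x hx => by
    rw [hfi x hx, inner_add_left, inner_smul_left, (P.frame_inner (θ x) (hηx x hx)).2.2.1,
      real_inner_comm]
    simp only [hν]
    rw [normal, hjoin x hx, mul_zero, add_zero]
  have hνu : IsUnitNormal f u (ν u) := by
    have hfr := P.frame_inner (θ u) (hηx u huW)
    refine ⟨?_, ?_, fun i => hfν i u huW⟩
    · refine (pow_eq_one_iff_of_nonneg (norm_nonneg _) two_ne_zero).1 ?_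
      rw [← real_inner_self_eq_norm_sq]
      exact hfr.2.1
    · rw [hfx u huW]
      exact hfr.2.2.2.1
  refine ⟨ν u, fun i => ⟪P.tangent (θ u) (η u), pderiv i f u⟫_ℝ, hνu, ?_, ?_⟩
  · ext i j
    have h1 := pderiv_inner (differentiableAt_of_contDiffOn hWo (contDiffOn_pderiv hWo hsm j) huW)
      hdν i
    rw [pderiv_eq_zero_of_const hWo (hfν j) i huW, hνi, inner_add_right, inner_smul_right,
      inner_smul_right, real_inner_comm (pderiv i f u) (pderiv j f u),
      real_inner_comm (P.tangent (θ u) (η u)), ← hft u huW i, hθu] at h1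
    simp only [secondForm, metric, Matrix.of_apply, Matrix.add_apply, Matrix.smul_apply,
      Matrix.vecMulVec_apply, smul_eq_mul, hθu]
    linarith
  · have hfr := P.frame_inner (θ u) (hηx u huW)
    have h1 := inner_eq_frame (hf.immersion u hu) (hs u hu)
      (inner_pderiv_self hf.isOpen_source hf.contDiffOn hs hu) hνu
      (P.tangent (θ u) (η u)) (P.tangent (θ u) (η u))
    have h2 : ⟪P.tangent (θ u) (η u), f u⟫_ℝ = 0 := by
      rw [hfx u huW]
      exact hfr.2.2.2.2
    rw [hfr.1, h2, show ⟪P.tangent (θ u) (η u), ν u⟫_ℝ = 0 from hfr.2.2.1] at h1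
    simp only [mul_zero, add_zero] at h1
    rw [h1, dotProduct, Finset.sum_comm]
    refine Finset.sum_congr rfl fun i _ => ?_
    rw [Matrix.mulVec, dotProduct, Finset.sum_mul]
    exact Finset.sum_congr rfl fun j _ => by rw [metric_inv_symm f u j i]

lemma mem_surface_of_isLocalParam {U : Set (E n)} {f : E n → E (n + 2)}
    (hf : IsLocalParam P.surface U f) {u : E n} (hu : u ∈ U) : f u ∈ P.surface := by
  obtain ⟨V, -, hV⟩ := hf.image_open
  exact (hV ▸ Set.mem_image_of_mem f hu : f u ∈ P.surface ∩ V).1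

lemma norm_eq_one_of_isLocalParam {U : Set (E n)} {f : E n → E (n + 2)}
    (hf : IsLocalParam P.surface U f) {u : E n} (hu : u ∈ U) : ‖f u‖ = 1 := by
  obtain ⟨θ, η, hη, h⟩ := P.mem_surface_of_isLocalParam hf hu
  rw [h, P.norm_point θ hη]

lemma mean_eq' (θ : ℝ) : n * (-(P.w θ / P.r θ)) ^ 2
    + 2 * (-(P.w θ / P.r θ)) * (-(P.κ θ - P.w θ / P.r θ)) = n * H := by
  have hr := (P.r_pos θ).ne'
  have := P.mean_eq θ
  field_simp
  linear_combination -this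

lemma hasConstantSecondMeanCurvature (hn : 2 ≤ n) :
    HasConstantSecondMeanCurvature n P.surface H := by
  intro U f hf u hu ν' hν'
  obtain ⟨θ, η, hη, h⟩ := P.mem_surface_of_isLocalParam hf hu
  obtain ⟨ν, y, hν, hh, hy⟩ := P.exists_secondForm hf hu hη h
  have himm := hf.immersion u hu
  have hn' : (n : ℝ) ≠ 0 := by positivity
  have hm := P.mean_eq' θ
  rcases eq_or_eq_neg_of_isUnitNormal himm (P.norm_eq_one_of_isLocalParam hf hu)
    (inner_pderiv_self hf.isOpen_source hf.contDiffOn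
      (fun x hx => P.norm_eq_one_of_isLocalParam hf hx) hu) hν hν' with rfl | rfl
  · rw [mthMeanCurvature_two_of_secondForm_eq hn himm hh hy, hm, mul_div_cancel_left₀ _ hn']
  · have hh' : secondForm f (-ν) u = (P.w θ / P.r θ) • metric f u
        + (P.κ θ - P.w θ / P.r θ) • Matrix.vecMulVec y y := by
      have : secondForm f (-ν) u = - secondForm f ν u := by
        ext i j
        simp [secondForm]
      rw [this, hh]
      module
    rw [mthMeanCurvature_two_of_secondForm_eq hn himm hh' hy, div_eq_iff hn', mul_comm H, ← hm]
    ring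

lemma hasConstantScalarCurvature :
    HasConstantScalarCurvature n P.surface (n * (n - 1) * (1 + H)) := by
  intro U f hf u hu
  obtain ⟨θ, η, hη, h⟩ := P.mem_surface_of_isLocalParam hf hu
  obtain ⟨ν, y, hν, hh, hy⟩ := P.exists_secondForm hf hu hη h
  rw [scalarCurvature_of_secondForm_eq hf.isOpen_source hf.contDiffOn hf.immersion
    (fun x hx => P.norm_eq_one_of_isLocalParam hf hx) hu hν hh hy, P.mean_eq' θ]
  ring

lemma ricciNormSq_eq {U : Set (E n)} {f : E n → E (n + 2)} (hf : IsLocalParam P.surface U f)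
    {u : E n} (hu : u ∈ U) {θ : ℝ} {η : E n} (hη : ‖η‖ = 1) (hfu : f u = P.point θ η) :
    n * ricciNormSq (metric f) u = ((n - 1) * (n + n * H)) ^ 2
      + (n - 1) * ((n - 2) * n / 2) ^ 2 * (H - (P.w θ / P.r θ) ^ 2) ^ 2 := by
  obtain ⟨ν, y, hν, hh, hy⟩ := P.exists_secondForm hf hu hη hfu
  have hm := P.mean_eq' θ
  rw [ricciNormSq_of_secondForm_eq hf.isOpen_source hf.contDiffOn hf.immersion
    (fun x hx => P.norm_eq_one_of_isLocalParam hf hx) hu hν hh hy, hm]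
  have : -(P.w θ / P.r θ) * -(P.κ θ - P.w θ / P.r θ) = n / 2 * (H - (P.w θ / P.r θ) ^ 2) := by
    linear_combination hm / 2
  rw [mul_assoc ((n : ℝ) - 2), this]
  ring

lemma not_areIsometric (hn : 3 ≤ n) {M : Set (E (n + 2))}
    (hM : ∃ K : ℝ, ∀ (U : Set (E n)) (f : E n → E (n + 2)), IsLocalParam M U f →
      ∀ u ∈ U, ricciNormSq (metric f) u = K) : ¬ AreIsometric n P.surface M := by
  rintro ⟨φ, -, hφ⟩
  obtain ⟨K, hK⟩ := hM
  obtain ⟨θ₁, θ₂, hne⟩ := P.nonconst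
  have hn3 : (3 : ℝ) ≤ n := by exact_mod_cast hn
  obtain ⟨η, hη⟩ : ∃ η : E n, ‖η‖ = 1 :=
    ⟨EuclideanSpace.single ⟨0, by omega⟩ 1, by simp⟩
  have key : ∀ θ, n * K = ((n - 1) * (n + n * H)) ^ 2
      + (n - 1) * ((n - 2) * n / 2) ^ 2 * (H - (P.w θ / P.r θ) ^ 2) ^ 2 := fun θ => by
    have hc := P.isLocalParam_chart hη θ
    obtain ⟨h0, h1⟩ := P.point_mem_chart hη θ
    obtain ⟨h2, h3⟩ := hφ _ _ hc
    rw [← hK _ _ h2 0 h0, ricciNormSq_congr hc.isOpen_source h3 h0, P.ricciNormSq_eq hc h0 hη h1]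
  refine hne (mul_left_cancel₀ (a := ((n : ℝ) - 1) * ((n - 2) * n / 2) ^ 2) ?_ ?_)
  · have h1 : (0 : ℝ) < n - 1 := by linarith
    have h2 : (0 : ℝ) < n - 2 := by linarith
    positivity
  · linarith [key θ₁, key θ₂]

lemma isNontrivial (hn : 3 ≤ n) : IsNontrivial n P.surface :=
  ⟨fun _ hc hc' => P.not_areIsometric hn (exists_ricciNormSq_roundSphere n hc hc'),
    fun l _ _ _ _ ha hb hab =>
      P.not_areIsometric hn (exists_ricciNormSq_cliffordHypersurface n l ha hb hab)⟩

end Profile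

/-! ### The polynomial of the profile equation

For the ratio `t` of its two positive roots, the polynomial `ρ^{n-2} - ρ^n - const` is, after
scaling the larger root to `1`, proportional to `x^{n-2} - A x^n - (1 - A)` with
`A = (1 + ⋯ + t^{n-3}) / (1 + ⋯ + t^{n-1})`. Here `n = p + 3`. -/

section Polynomials

/-- The geometric sum `1 + t + ⋯ + t^{k-1}`. -/
def geomSum (k : ℕ) (t : ℝ) : ℝ := ∑ i ∈ Finset.range k, t ^ i

/-- The divided difference of the `j`-th power. -/
def powDiff (j : ℕ) (t x : ℝ) : ℝ := ∑ a ∈ Finset.range j, x ^ a * t ^ (j - 1 - a)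

/-- The square of the larger root. -/
noncomputable def rootSq (p : ℕ) (t : ℝ) : ℝ := geomSum (p + 1) t / geomSum (p + 3) t

/-- The numerator of the positive cofactor of the two positive roots. -/
def cofactorNum (p : ℕ) (t x : ℝ) : ℝ :=
  ∑ i ∈ Finset.range (p + 1), t ^ i * x ^ i * (powDiff (p + 1 - i) t x + powDiff (p + 2 - i) t x)

/-- The positive cofactor of the two positive roots. -/
noncomputable def cofactor (p : ℕ) (t x : ℝ) : ℝ := cofactorNum p t x / geomSum (p + 3) t

lemma continuous_geomSum (k : ℕ) : Continuous (geomSum k) := by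
  unfold geomSum
  fun_prop

lemma continuous_cofactorNum (p : ℕ) : Continuous fun q : ℝ × ℝ => cofactorNum p q.1 q.2 := by
  unfold cofactorNum powDiff
  fun_prop

lemma contDiff_cofactor (p : ℕ) (t : ℝ) : ContDiff ℝ ∞ (cofactor p t) := by
  unfold cofactor cofactorNum powDiff
  fun_prop

lemma one_le_geomSum {k : ℕ} (hk : 1 ≤ k) {t : ℝ} (ht : 0 ≤ t) : 1 ≤ geomSum k t := by
  have h := Finset.single_le_sum (f := fun i => t ^ i) (s := Finset.range k)
    (fun i _ => pow_nonneg ht i) (Finset.mem_range.2 hk)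
  simpa [geomSum] using h

lemma geomSum_le {k : ℕ} {t : ℝ} (ht : 0 ≤ t) (ht' : t ≤ 1) : geomSum k t ≤ k := by
  unfold geomSum
  calc _ ≤ ∑ _i ∈ Finset.range k, (1 : ℝ) := Finset.sum_le_sum fun i _ => pow_le_one₀ ht ht'
    _ = k := by simp

lemma geomSum_add_three (p : ℕ) (t : ℝ) :
    geomSum (p + 3) t = geomSum (p + 1) t + t ^ (p + 1) + t ^ (p + 2) := by
  simp only [geomSum, Finset.sum_range_succ]

lemma mul_cofactorNum (p : ℕ) (t x : ℝ) :
    (x - t) * cofactorNum p t x =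
      geomSum (p + 1) t * geomSum (p + 3) x - geomSum (p + 3) t * geomSum (p + 1) x := by
  have h1 : (x - t) * cofactorNum p t x =
      geomSum (p + 1) t * (x ^ (p + 1) + x ^ (p + 2))
        - geomSum (p + 1) x * (t ^ (p + 1) + t ^ (p + 2)) := by
    simp only [cofactorNum, geomSum, Finset.mul_sum, Finset.sum_mul]
    rw [← Finset.sum_sub_distrib]
    refine Finset.sum_congr rfl fun i hi => ?_
    have hi' : i < p + 1 := Finset.mem_range.1 hi
    have e1 := (Commute.all x t).mul_geom_sum₂ (p + 1 - i)
    have e2 := (Commute.all x t).mul_geom_sum₂ (p + 2 - i)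
    have p1 : ∀ y : ℝ, y ^ (p + 1) = y ^ i * y ^ (p + 1 - i) := fun y => by
      rw [← pow_add]; congr 1; omega
    have p2 : ∀ y : ℝ, y ^ (p + 2) = y ^ i * y ^ (p + 2 - i) := fun y => by
      rw [← pow_add]; congr 1; omega
    rw [p1 x, p2 x, p1 t, p2 t]
    unfold powDiff
    linear_combination (t ^ i * x ^ i) * (e1 + e2)
  rw [h1, geomSum_add_three, geomSum_add_three]
  ring

/-- The factorization of the polynomial of the profile equation. -/
lemma profile_polynomial_eq (p : ℕ) {t : ℝ} (ht : 0 ≤ t) (x : ℝ) :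
    x ^ (p + 1) - rootSq p t * x ^ (p + 3) - (1 - rootSq p t) =
      (1 - x) * (x - t) * cofactor p t x := by
  have hS : geomSum (p + 3) t ≠ 0 := (zero_lt_one.trans_le (one_le_geomSum (by omega) ht)).ne'
  have h1 := mul_cofactorNum p t x
  have h2 := mul_neg_geom_sum x (p + 1)
  have h3 := mul_neg_geom_sum x (p + 3)
  rw [rootSq, cofactor]
  unfold geomSum at *
  field_simp
  linear_combination (-(1 - x)) * h1 + (∑ i ∈ Finset.range (p + 3), t ^ i) * h2
    - (∑ i ∈ Finset.range (p + 1), t ^ i) * h3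

lemma powDiff_nonneg (j : ℕ) {t x : ℝ} (ht : 0 ≤ t) (hx : 0 ≤ x) : 0 ≤ powDiff j t x :=
  Finset.sum_nonneg fun _ _ => mul_nonneg (pow_nonneg hx _) (pow_nonneg ht _)

lemma pow_le_cofactorNum (p : ℕ) {t x : ℝ} (ht : 0 ≤ t) (hx : 0 ≤ x) :
    x ^ p ≤ cofactorNum p t x := by
  have h1 : x ^ p ≤ powDiff (p + 1) t x := by
    have h := Finset.single_le_sum (f := fun a => x ^ a * t ^ (p + 1 - 1 - a))
      (s := Finset.range (p + 1))
      (fun i _ => mul_nonneg (pow_nonneg hx _) (pow_nonneg ht _)) (Finset.self_mem_range_succ p)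
    simpa [powDiff] using h
  have h2 := Finset.single_le_sum (f := fun i => t ^ i * x ^ i *
      (powDiff (p + 1 - i) t x + powDiff (p + 2 - i) t x)) (s := Finset.range (p + 1))
      (fun i _ => mul_nonneg (mul_nonneg (pow_nonneg ht _) (pow_nonneg hx _))
        (add_nonneg (powDiff_nonneg _ ht hx) (powDiff_nonneg _ ht hx)))
      (Finset.mem_range.2 (Nat.succ_pos p))
  have h3 := powDiff_nonneg (p + 2) ht hx
  simp only [pow_zero, Nat.sub_zero, one_mul] at h2
  unfold cofactorNum
  linarith

lemma cofactor_pos (p : ℕ) {t x : ℝ} (ht : 0 ≤ t) (hx : 0 < x) : 0 < cofactor p t x :=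
  div_pos ((pow_pos hx p).trans_le (pow_le_cofactorNum p ht hx.le))
    (zero_lt_one.trans_le (one_le_geomSum (by omega) ht))

lemma rootSq_pos (p : ℕ) {t : ℝ} (ht : 0 ≤ t) : 0 < rootSq p t :=
  div_pos (zero_lt_one.trans_le (one_le_geomSum (by omega) ht))
    (zero_lt_one.trans_le (one_le_geomSum (by omega) ht))

lemma one_sub_rootSq (p : ℕ) {t : ℝ} (ht : 0 ≤ t) :
    1 - rootSq p t = t ^ (p + 1) * (1 + t) / geomSum (p + 3) t := by
  have hS : geomSum (p + 3) t ≠ 0 := (zero_lt_one.trans_le (one_le_geomSum (by omega) ht)).ne'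
  rw [rootSq, eq_div_iff hS, sub_mul, div_mul_cancel₀ _ hS, geomSum_add_three]
  ring

lemma rootSq_le_one (p : ℕ) {t : ℝ} (ht : 0 ≤ t) : rootSq p t ≤ 1 := by
  have h : 0 ≤ 1 - rootSq p t := by
    rw [one_sub_rootSq p ht]
    exact div_nonneg (by positivity) (zero_le_one.trans (one_le_geomSum (by omega) ht))
  linarith

lemma rootSq_lt_one (p : ℕ) {t : ℝ} (ht : 0 < t) : rootSq p t < 1 := by
  have h : 0 < 1 - rootSq p t := by
    rw [one_sub_rootSq p ht.le]
    exact div_pos (by positivity) (zero_lt_one.trans_le (one_le_geomSum (by omega) ht.le))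
  linarith

lemma pow_div_cofactor_le (p : ℕ) {t x : ℝ} (ht : 0 ≤ t) (ht' : t ≤ 1) (hx : 0 ≤ x)
    (hx' : x ≤ 1) : x ^ (p + 1) / cofactor p t x ≤ p + 3 := by
  rcases hx.eq_or_lt with rfl | hx
  · rw [zero_pow (by omega), zero_div]
    positivity
  rw [div_le_iff₀ (cofactor_pos p ht hx), cofactor]
  have hS := zero_lt_one.trans_le (one_le_geomSum (k := p + 3) (by omega) ht)
  rw [mul_div_assoc', le_div_iff₀ hS]
  have h1 := pow_le_cofactorNum p ht hx.le
  have h2 : geomSum (p + 3) t ≤ p + 3 := by exact_mod_cast geomSum_le (k := p + 3) ht ht'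
  have h3 : x ^ (p + 1) ≤ x ^ p := pow_le_pow_of_le_one hx.le hx' (by omega)
  calc x ^ (p + 1) * geomSum (p + 3) t ≤ x ^ p * (p + 3) :=
        mul_le_mul h3 h2 hS.le (pow_nonneg hx.le p)
    _ ≤ (p + 3) * cofactorNum p t x := by rw [mul_comm]; gcongr

lemma geomSum_one (k : ℕ) : geomSum k 1 = k := by simp [geomSum]

lemma geomSum_zero {k : ℕ} : geomSum (k + 1) 0 = 1 := by
  simp [geomSum, Finset.sum_range_succ']

lemma cofactorNum_one (p : ℕ) : cofactorNum p 1 1 = (p + 1) * (p + 3) := by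
  have h : ∀ (M : ℝ) (j : ℕ), ∑ i ∈ Finset.range j, (M - 2 * i) = j * M - j * (j - 1) := by
    intro M j
    induction j with
    | zero => simp
    | succ j ih =>
      rw [Finset.sum_range_succ, ih]
      push_cast
      ring
  have h2 : cofactorNum p 1 1 = ∑ i ∈ Finset.range (p + 1), ((2 * p + 3 : ℝ) - 2 * i) := by
    unfold cofactorNum powDiff
    refine Finset.sum_congr rfl fun i hi => ?_
    have hi' := Finset.mem_range.1 hi
    simp only [one_pow, mul_one, one_mul, Finset.sum_const, Finset.card_range, nsmul_eq_mul]
    rw [Nat.cast_sub (by omega), Nat.cast_sub (by omega)]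
    push_cast
    ring
  rw [h2, h]
  push_cast
  ring

lemma powDiff_zero (j : ℕ) (x : ℝ) : powDiff (j + 1) 0 x = x ^ j := by
  unfold powDiff
  rw [Finset.sum_range_succ, Finset.sum_eq_zero fun a ha => ?_]
  · simp
  · have := Finset.mem_range.1 ha
    rw [zero_pow (by omega), mul_zero]

lemma cofactor_zero (p : ℕ) (x : ℝ) : cofactor p 0 x = x ^ p * (1 + x) := by
  rw [cofactor, geomSum_zero, div_one, cofactorNum, Finset.sum_range_succ',
    Finset.sum_eq_zero fun a _ => ?_]
  · simp only [pow_zero, Nat.sub_zero, powDiff_zero]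
    ring
  · rw [zero_pow (by omega)]
    ring

lemma rootSq_zero (p : ℕ) : rootSq p 0 = 1 := by simp [rootSq, geomSum_zero]

end Polynomials

/-! ### The angle function and its period -/

section Period

/-- The normalized radius, oscillating between `t` and `1`. -/
noncomputable def radius (t ψ : ℝ) : ℝ := (1 + t) / 2 - (1 - t) / 2 * Real.cos ψ

/-- The squared radius scale. -/
noncomputable def scaleSq (p : ℕ) (H t : ℝ) : ℝ := rootSq p t / (1 + H)

/-- The square of the function `w` of the profile, in terms of the normalized radius. -/
noncomputable def heightSq (p : ℕ) (H t x : ℝ) : ℝ :=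
  H * scaleSq p H t * x ^ 2 + (1 - rootSq p t) / x ^ (p + 1)

/-- The derivative of arc length with respect to the phase. -/
noncomputable def arcSpeed (p : ℕ) (H t x : ℝ) : ℝ :=
  √(scaleSq p H t * (x ^ (p + 1) / cofactor p t x))

/-- The derivative of the polar angle with respect to the phase. -/
noncomputable def angleSpeed (p : ℕ) (H t x : ℝ) : ℝ :=
  arcSpeed p H t x * √(heightSq p H t x) / (1 - scaleSq p H t * x ^ 2)

variable {p : ℕ} {H t x : ℝ}

lemma radius_le_one (ht' : t ≤ 1) (ψ : ℝ) : radius t ψ ≤ 1 := by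
  have := Real.neg_one_le_cos ψ
  unfold radius
  nlinarith

lemma le_radius (ht' : t ≤ 1) (ψ : ℝ) : t ≤ radius t ψ := by
  have := Real.cos_le_one ψ
  unfold radius
  nlinarith

lemma one_sub_radius_mul (t ψ : ℝ) :
    (1 - radius t ψ) * (radius t ψ - t) = ((1 - t) / 2 * Real.sin ψ) ^ 2 := by
  unfold radius
  linear_combination (-((1 - t) / 2) ^ 2) * Real.sin_sq_add_cos_sq ψ

lemma hasDerivAt_radius (t ψ : ℝ) : HasDerivAt (radius t) ((1 - t) / 2 * Real.sin ψ) ψ := by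
  have h := ((Real.hasDerivAt_cos ψ).const_mul ((1 - t) / 2)).const_sub ((1 + t) / 2)
  exact h.congr_deriv (by ring)

lemma contDiff_radius (t : ℝ) : ContDiff ℝ ∞ (radius t) := by
  unfold radius
  fun_prop

lemma continuous_radius : Continuous fun q : ℝ × ℝ => radius q.1 q.2 := by
  unfold radius
  fun_prop

lemma periodic_radius (t : ℝ) : Function.Periodic (radius t) (2 * Real.pi) := fun ψ => by
  simp [radius]

lemma scaleSq_pos (hH : 0 < H) (ht : 0 ≤ t) : 0 < scaleSq p H t :=
  div_pos (rootSq_pos p ht) (by linarith)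

lemma scaleSq_mul_le (hH : 0 < H) (ht : 0 ≤ t) (hx : 0 ≤ x) (hx' : x ≤ 1) :
    scaleSq p H t * x ^ 2 ≤ 1 / (1 + H) := by
  have h1 := rootSq_le_one p ht
  have h2 : x ^ 2 ≤ 1 := pow_le_one₀ hx hx'
  have h3 := scaleSq_pos (p := p) hH ht
  calc scaleSq p H t * x ^ 2 ≤ scaleSq p H t * 1 := by gcongr
    _ ≤ 1 / (1 + H) := by
      rw [mul_one, scaleSq]
      gcongr

lemma le_one_sub_scaleSq_mul (hH : 0 < H) (ht : 0 ≤ t) (hx : 0 ≤ x) (hx' : x ≤ 1) :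
    H / (1 + H) ≤ 1 - scaleSq p H t * x ^ 2 := by
  have h := scaleSq_mul_le (p := p) hH ht hx hx'
  have h2 : H / (1 + H) = 1 - 1 / (1 + H) := by
    field_simp
    ring
  linarith

lemma heightSq_pos (hH : 0 < H) (ht : 0 ≤ t) (hx : 0 < x) : 0 < heightSq p H t x := by
  have h1 := scaleSq_pos (p := p) hH ht
  have h2 := rootSq_le_one p ht
  have h3 : 0 ≤ (1 - rootSq p t) / x ^ (p + 1) := div_nonneg (by linarith) (by positivity)
  unfold heightSq
  positivity

/-- The arc length identity of the profile. -/
lemma scaleSq_add_heightSq_add (hH : 0 < H) (ht : 0 ≤ t) (hx : 0 < x) :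
    scaleSq p H t * x ^ 2 + heightSq p H t x
      + (1 - x) * (x - t) * (cofactor p t x / x ^ (p + 1)) = 1 := by
  have h := profile_polynomial_eq p ht x
  have hx' := (pow_pos hx (p + 1)).ne'
  have hH' : 1 + H ≠ 0 := by positivity
  rw [← mul_div_assoc, ← h, heightSq, scaleSq]
  field_simp
  ring

lemma heightSq_le_one (hH : 0 < H) (ht : 0 ≤ t) (hx : 0 < x) (htx : t ≤ x) (hx' : x ≤ 1) :
    heightSq p H t x ≤ 1 := by
  have h1 := scaleSq_add_heightSq_add (p := p) hH ht hx
  have h2 := (scaleSq_pos (p := p) hH ht).le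
  have h3 := (cofactor_pos p ht hx).le
  have h4 : 0 ≤ (1 - x) * (x - t) * (cofactor p t x / x ^ (p + 1)) :=
    mul_nonneg (mul_nonneg (by linarith) (by linarith)) (div_nonneg h3 (by positivity))
  nlinarith [mul_nonneg h2 (sq_nonneg x)]

lemma arcSpeed_pos (hH : 0 < H) (ht : 0 ≤ t) (hx : 0 < x) : 0 < arcSpeed p H t x :=
  Real.sqrt_pos.2 (mul_pos (scaleSq_pos hH ht) (div_pos (by positivity) (cofactor_pos p ht hx)))

lemma angleSpeed_pos (hH : 0 < H) (ht : 0 ≤ t) (hx : 0 < x) (hx' : x ≤ 1) :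
    0 < angleSpeed p H t x :=
  div_pos (mul_pos (arcSpeed_pos hH ht hx) (Real.sqrt_pos.2 (heightSq_pos hH ht hx)))
    ((by positivity : 0 < H / (1 + H)).trans_le (le_one_sub_scaleSq_mul hH ht hx.le hx'))

lemma norm_angleSpeed_le (hH : 0 < H) (ht : 0 ≤ t) (htx : t ≤ x) (hx' : x ≤ 1) :
    ‖angleSpeed p H t x‖ ≤ √(p + 3) * ((1 + H) / H) := by
  have hx : 0 ≤ x := ht.trans htx
  rcases hx.eq_or_lt with rfl | hx
  · rw [angleSpeed, arcSpeed, zero_pow (by omega)]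
    simp only [zero_div, mul_zero, Real.sqrt_zero, zero_mul, norm_zero]
    positivity
  have hD := le_one_sub_scaleSq_mul (p := p) hH ht hx.le hx'
  have hD0 : 0 < H / (1 + H) := by positivity
  have h1 : arcSpeed p H t x ≤ √(p + 3) := by
    refine Real.sqrt_le_sqrt ?_
    have h2 := pow_div_cofactor_le p ht (htx.trans hx') hx.le hx'
    have h3 : scaleSq p H t ≤ 1 := by
      rw [scaleSq]
      exact div_le_one_of_le₀ (by linarith [rootSq_le_one p ht]) (by linarith)
    have h4 : 0 ≤ x ^ (p + 1) / cofactor p t x :=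
      div_nonneg (by positivity) (cofactor_pos p ht hx).le
    calc _ ≤ 1 * (x ^ (p + 1) / cofactor p t x) := by gcongr
      _ ≤ _ := by rw [one_mul]; exact h2
  have h2 : √(heightSq p H t x) ≤ 1 := by
    rw [← Real.sqrt_one]
    exact Real.sqrt_le_sqrt (heightSq_le_one hH ht hx htx hx')
  rw [Real.norm_eq_abs, abs_of_pos (angleSpeed_pos hH ht hx hx'), angleSpeed]
  calc arcSpeed p H t x * √(heightSq p H t x) / (1 - scaleSq p H t * x ^ 2)
      ≤ √(p + 3) * 1 / (H / (1 + H)) := by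
        gcongr
    _ = √(p + 3) * ((1 + H) / H) := by
        field_simp

lemma continuousAt_angleSpeed (hH : 0 < H) (ht : 0 ≤ t) (hx : 0 < x) (hx' : x ≤ 1) :
    ContinuousAt (fun q : ℝ × ℝ => angleSpeed p H q.1 q.2) (t, x) := by
  have hS := (zero_lt_one.trans_le (one_le_geomSum (k := p + 3) (by omega) ht)).ne'
  have hg : ∀ k, ContinuousAt (fun q : ℝ × ℝ => geomSum k q.1) (t, x) := fun k =>
    ((continuous_geomSum k).comp continuous_fst).continuousAt
  have hx1 : ContinuousAt (fun q : ℝ × ℝ => q.2) (t, x) := continuous_snd.continuousAt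
  have hR : ContinuousAt (fun q : ℝ × ℝ => rootSq p q.1) (t, x) := (hg _).div₀ (hg _) hS
  have hsc : ContinuousAt (fun q : ℝ × ℝ => scaleSq p H q.1) (t, x) := hR.div_const _
  have hcf : ContinuousAt (fun q : ℝ × ℝ => cofactor p q.1 q.2) (t, x) :=
    (continuous_cofactorNum p).continuousAt.div₀ (hg _) hS
  have hw : ContinuousAt (fun q : ℝ × ℝ => heightSq p H q.1 q.2) (t, x) :=
    ((continuousAt_const.mul hsc).mul (hx1.pow 2)).add
      ((continuousAt_const.sub hR).div₀ (hx1.pow _) (pow_pos hx _).ne')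
  have harc : ContinuousAt (fun q : ℝ × ℝ => arcSpeed p H q.1 q.2) (t, x) :=
    (hsc.mul ((hx1.pow _).div₀ hcf (cofactor_pos p ht hx).ne')).sqrt
  refine (harc.mul hw.sqrt).div₀ (continuousAt_const.sub (hsc.mul (hx1.pow 2))) ?_
  exact ((by positivity : 0 < H / (1 + H)).trans_le
    (le_one_sub_scaleSq_mul hH ht hx.le hx')).ne'

lemma measurable_angleSpeed (p : ℕ) (H t : ℝ) : Measurable (angleSpeed p H t) := by
  have h := (contDiff_cofactor p t).continuous.measurable
  unfold angleSpeed arcSpeed heightSq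
  fun_prop

/-- The increment of the polar angle over a period of the radius. -/
noncomputable def anglePeriod (p : ℕ) (H t : ℝ) : ℝ :=
  ∫ ψ in (0 : ℝ)..2 * Real.pi, angleSpeed p H t (radius t ψ)

lemma radius_pos_of_mem_Ioo (ht : 0 ≤ t) (ht' : t ≤ 1) {ψ : ℝ}
    (hψ : ψ ∈ Set.Ioo 0 (2 * Real.pi)) : 0 < radius t ψ := by
  have hcos : Real.cos ψ < 1 := by
    refine lt_of_le_of_ne (Real.cos_le_one ψ) fun h => ?_
    have := (Real.cos_eq_one_iff_of_lt_of_lt (by linarith [hψ.1, Real.pi_pos]) hψ.2).1 h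
    exact hψ.1.ne' this
  unfold radius
  rcases ht'.eq_or_lt with rfl | h
  · norm_num
  · nlinarith

lemma continuousOn_anglePeriod (hH : 0 < H) :
    ContinuousOn (anglePeriod p H) (Set.Icc 0 1) := by
  intro t₀ ht₀
  refine intervalIntegral.continuousWithinAt_of_dominated_interval
    (bound := fun _ => √(p + 3) * ((1 + H) / H)) ?_ ?_ intervalIntegrable_const ?_
  · refine Filter.Eventually.of_forall fun t => Measurable.aestronglyMeasurable ?_
    exact (measurable_angleSpeed p H t).comp (contDiff_radius t).continuous.measurable
  · filter_upwards [self_mem_nhdsWithin] with t ht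
    exact Filter.Eventually.of_forall fun ψ _ =>
      norm_angleSpeed_le hH ht.1 (le_radius ht.2 ψ) (radius_le_one ht.2 ψ)
  · filter_upwards [MeasureTheory.Measure.ae_ne MeasureTheory.volume (2 * Real.pi)] with ψ hψ hψ'
    rw [Set.uIoc_of_le Real.two_pi_pos.le] at hψ'
    have hpos := radius_pos_of_mem_Ioo ht₀.1 ht₀.2 ⟨hψ'.1, lt_of_le_of_ne hψ'.2 hψ⟩
    have h1 := continuousAt_angleSpeed (p := p) hH ht₀.1 hpos (radius_le_one ht₀.2 ψ)
    have h2 : ContinuousAt (fun t => (t, radius t ψ)) t₀ :=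
      (continuous_id.prodMk (continuous_radius.comp
        (continuous_id.prodMk continuous_const))).continuousAt
    exact (ContinuousAt.comp (f := fun t => (t, radius t ψ)) h1 h2).continuousWithinAt

lemma anglePeriod_one (hH : 0 < H) : anglePeriod p H 1 = 2 * Real.pi / √((p + 3) * H + 2) := by
  have hrad : ∀ ψ, radius 1 ψ = 1 := fun ψ => by
    unfold radius
    norm_num
  have hR : rootSq p 1 = (p + 1) / (p + 3) := by
    simp only [rootSq, geomSum_one]
    push_cast
    ring
  have hcf : cofactor p 1 1 = p + 1 := by
    rw [cofactor, cofactorNum_one, geomSum_one]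
    push_cast
    field_simp
  have hN : (0 : ℝ) < (p + 3) * H + 2 := by positivity
  have hsq := Real.sq_sqrt hN.le
  have hsq0 := Real.sqrt_pos.2 hN
  have h1 : arcSpeed p H 1 1 = √((p + 3) * (1 + H)) / ((p + 3) * (1 + H)) := by
    rw [Real.sqrt_div_self', arcSpeed, hcf, scaleSq, hR, one_pow, ← Real.sqrt_one,
      ← Real.sqrt_div zero_le_one]
    congr 1
    simp only [Real.sqrt_one]
    field_simp
  have h2 : heightSq p H 1 1 = ((p + 3) * H + 2) / ((p + 3) * (1 + H)) := by
    rw [heightSq, scaleSq, hR]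
    field_simp
    ring
  have h3 : 1 - scaleSq p H 1 * 1 ^ 2 = ((p + 3) * H + 2) / ((p + 3) * (1 + H)) := by
    rw [scaleSq, hR]
    field_simp
    ring
  have h4 : angleSpeed p H 1 1 = 1 / √((p + 3) * H + 2) := by
    rw [angleSpeed, h1, h2, h3, Real.sqrt_div hN.le]
    have h5 : 0 < √((p + 3) * (1 + H)) := Real.sqrt_pos.2 (by positivity)
    rw [div_eq_div_iff (by positivity) hsq0.ne']
    field_simp
    rw [hsq]
  simp only [anglePeriod, hrad, h4, intervalIntegral.integral_const, smul_eq_mul]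
  ring

lemma anglePeriod_zero (hH : 0 < H) : anglePeriod p H 0 = 2 * Real.arctan (1 / √H) := by
  have hs := Real.sqrt_pos.2 hH
  have hss := Real.sq_sqrt hH.le
  set X : ℝ → ℝ := fun ψ => Real.sin (ψ / 2) ^ 2 with hX
  have hXc : Continuous X := by
    rw [hX]
    fun_prop
  have hrad : ∀ ψ, radius 0 ψ = X ψ := fun ψ => by
    have := Real.cos_two_mul (ψ / 2)
    rw [mul_div_cancel₀ ψ two_ne_zero] at this
    have h2 := Real.sin_sq_add_cos_sq (ψ / 2)
    simp only [radius, hX]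
    linarith
  have hX0 : ∀ ψ, 0 ≤ X ψ := fun ψ => sq_nonneg _
  have hX1 : ∀ ψ, X ψ ^ 2 ≤ 1 := fun ψ => pow_le_one₀ (hX0 ψ) (Real.sin_sq_le_one _)
  set g : ℝ → ℝ := fun ψ =>
    √H * X ψ * Real.sin (ψ / 2) / (√(1 + X ψ) * (1 + H - X ψ ^ 2)) with hg
  have hpos1 : ∀ ψ, 0 < √(1 + X ψ) := fun ψ => Real.sqrt_pos.2 (by linarith [hX0 ψ])
  have hpos2 : ∀ ψ, 0 < 1 + H - X ψ ^ 2 := fun ψ => by linarith [hX1 ψ]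
  have hgc : Continuous g := by
    rw [hg]
    refine Continuous.div₀ (by fun_prop) (by fun_prop) fun ψ => ?_
    exact (mul_pos (hpos1 ψ) (hpos2 ψ)).ne'
  have hint : anglePeriod p H 0 = ∫ ψ in (0 : ℝ)..2 * Real.pi, g ψ := by
    refine intervalIntegral.integral_congr fun ψ hψ => ?_
    rw [Set.uIcc_of_le Real.two_pi_pos.le] at hψ
    have hsin : 0 ≤ Real.sin (ψ / 2) :=
      Real.sin_nonneg_of_nonneg_of_le_pi (by linarith [hψ.1]) (by linarith [hψ.2])
    simp only [hrad]
    rcases hsin.eq_or_lt with h0 | h0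
    · have hXz : X ψ = 0 := by simp [hX, ← h0]
      rw [hg, hXz, angleSpeed, arcSpeed, zero_pow (by omega)]
      simp [hXz]
    have hXp : 0 < X ψ := pow_pos h0 2
    have h1 : arcSpeed p H 0 (X ψ) = Real.sin (ψ / 2) / (√(1 + H) * √(1 + X ψ)) := by
      rw [arcSpeed, cofactor_zero, scaleSq, rootSq_zero, ← Real.sqrt_mul (by linarith),
        ← Real.sqrt_sq h0.le, ← Real.sqrt_div (sq_nonneg _)]
      congr 1
      change _ = X ψ / _
      rw [pow_succ]
      field_simp
    have h2 : √(heightSq p H 0 (X ψ)) = √H * X ψ / √(1 + H) := by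
      rw [heightSq, scaleSq, rootSq_zero, ← Real.sqrt_sq hXp.le, ← Real.sqrt_mul hH.le,
        ← Real.sqrt_div (by positivity), Real.sqrt_sq hXp.le]
      congr 1
      field_simp
      ring
    rw [hg, angleSpeed, h1, h2, scaleSq, rootSq_zero]
    have h3 : √(1 + H) ^ 2 = 1 + H := Real.sq_sqrt (by linarith)
    have h4 : 0 < √(1 + H) := Real.sqrt_pos.2 (by linarith)
    have h5 := hpos1 ψ
    have h6 := hpos2 ψ
    have h7 : 1 - 1 / (1 + H) * X ψ ^ 2 = (1 + H - X ψ ^ 2) / (√(1 + H) ^ 2) := by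
      rw [h3]
      field_simp
    rw [h7]
    field_simp
  have hder : ∀ ψ, HasDerivAt (fun ψ => -Real.arctan (Real.cos (ψ / 2) * √(1 + X ψ) / √H))
      (g ψ) ψ := fun ψ => by
    have hhalf : HasDerivAt (fun ψ : ℝ => ψ / 2) (1 / 2) ψ := (hasDerivAt_id ψ).div_const 2
    have hXd : HasDerivAt X (Real.sin (ψ / 2) * Real.cos (ψ / 2)) ψ :=
      (hhalf.sin.pow 2).congr_deriv (by simp; ring)
    have hsq := (hXd.const_add 1).sqrt (by linarith [hX0 ψ] : 1 + X ψ ≠ 0)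
    have hall := (((hhalf.cos.mul hsq).div_const √H).arctan).neg
    refine hall.congr_deriv ?_
    have h5 := hpos1 ψ
    have h6 := hpos2 ψ
    have h7 : √(1 + X ψ) ^ 2 = 1 + X ψ := Real.sq_sqrt (by linarith [hX0 ψ])
    have hcos : Real.cos (ψ / 2) ^ 2 = 1 - X ψ := by
      rw [hX]
      linarith [Real.sin_sq_add_cos_sq (ψ / 2)]
    have h8 : 1 + (Real.cos (ψ / 2) * √(1 + X ψ) / √H) ^ 2 = (1 + H - X ψ ^ 2) / √H ^ 2 := by
      rw [div_pow, mul_pow, h7, hcos, hss]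
      field_simp
      ring
    simp only [Pi.mul_apply] at *
    rw [h8, hg]
    field_simp
    rw [h7]
    linear_combination (-Real.sin (ψ / 2)) * hcos
  rw [hint, intervalIntegral.integral_eq_sub_of_hasDerivAt (fun ψ _ => hder ψ)
    (hgc.intervalIntegrable _ _)]
  have hX2 : X (2 * Real.pi) = 0 := by simp [hX]
  have hX00 : X 0 = 0 := by simp [hX]
  simp only [hX2, hX00, mul_div_cancel_left₀ Real.pi two_ne_zero, Real.cos_pi, zero_div,
    Real.cos_zero, add_zero, Real.sqrt_one, mul_one, neg_div, Real.arctan_neg]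
  ring

end Period

/-! ### Existence of profiles -/

/-- The inverse of the primitive of a positive periodic function. -/
lemma exists_inverse_primitive {I : ℝ → ℝ} {T : ℝ} (hT : 0 < T) (hI : ContDiff ℝ ∞ I)
    (hpos : ∀ x, 0 < I x) (hper : Function.Periodic I T) :
    ∃ g : ℝ → ℝ, ContDiff ℝ ∞ g ∧ Function.Surjective g ∧ (∀ θ, HasDerivAt g (I (g θ))⁻¹ θ) ∧
      ∀ θ, g (θ + ∫ x in (0 : ℝ)..T, I x) = g θ + T := by
  set F : ℝ → ℝ := fun x => ∫ y in (0 : ℝ)..x, I y with hF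
  have hint : ∀ a b, IntervalIntegrable I MeasureTheory.volume a b := fun a b =>
    hI.continuous.intervalIntegrable a b
  have hder : ∀ x, HasDerivAt F (I x) x := fun x =>
    intervalIntegral.integral_hasDerivAt_right (hint 0 x)
      (hI.continuous.stronglyMeasurableAtFilter _ _) hI.continuous.continuousAt
  have hFc : Continuous F := continuous_iff_continuousAt.2 fun x => (hder x).continuousAt
  have hmono : StrictMono F := strictMono_of_hasDerivAt_pos hder hpos
  have hsurj : Function.Surjective F := hFc.surjective
    (hper.tendsto_atTop_intervalIntegral_of_pos' (hint 0 T) hpos hT)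
    (hper.tendsto_atBot_intervalIntegral_of_pos' (hint 0 T) hpos hT)
  have hFs : ContDiff ℝ ∞ F := by
    refine contDiff_infty_iff_deriv.2 ⟨fun x => (hder x).differentiableAt, ?_⟩
    rwa [funext fun x => (hder x).deriv]
  set e : ℝ ≃ₜ ℝ := (hmono.orderIsoOfSurjective F hsurj).toHomeomorph with he
  have heF : ∀ x, e x = F x := fun x => rfl
  have hFT : ∀ x, F (x + T) = F x + ∫ y in (0 : ℝ)..T, I y := fun x => by
    have h1 := intervalIntegral.integral_add_adjacent_intervals (hint 0 x) (hint x (x + T))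
    have h2 := hper.intervalIntegral_add_eq x 0
    rw [zero_add] at h2
    simp only [hF]
    rw [← h1, h2]
  refine ⟨e.symm, e.contDiff_symm_deriv (fun x => (hpos x).ne') hder hFs, e.symm.surjective,
    fun θ => ?_, fun θ => ?_⟩
  · refine HasDerivAt.of_local_left_inverse e.symm.continuous.continuousAt (hder _) (hpos _).ne' ?_
    exact Filter.Eventually.of_forall fun y => e.apply_symm_apply y
  · rw [Homeomorph.symm_apply_eq, heF, hFT, ← heF, e.apply_symm_apply]

lemma dense_sin_ne_zero : Dense {x : ℝ | Real.sin x ≠ 0} := by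
  have h : {x : ℝ | Real.sin x = 0}.Countable := by
    refine (Set.countable_range fun n : ℤ => (n : ℝ) * Real.pi).mono fun x hx => ?_
    exact Real.sin_eq_zero_iff.1 hx
  exact h.dense_compl ℝ

section Phase

variable {p : ℕ} {H t : ℝ}

/-- The derivative of the radius with respect to arc length, as a function of the phase. -/
noncomputable def radialSpeed (p : ℕ) (t ψ : ℝ) : ℝ :=
  (1 - t) / 2 * Real.sin ψ * √(cofactor p t (radius t ψ) / radius t ψ ^ (p + 1))

/-- The derivative of the height with respect to the radius. -/
noncomputable def heightSlope (p : ℕ) (H t x : ℝ) : ℝ :=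
  (2 * (H * scaleSq p H t * x) - (p + 1) * (1 - rootSq p t) / x ^ (p + 2)) /
    (2 * √(heightSq p H t x) * √(scaleSq p H t))

lemma radius_pos (ht : 0 < t) (ht' : t ≤ 1) (ψ : ℝ) : 0 < radius t ψ :=
  ht.trans_le (le_radius ht' ψ)

lemma contDiff_comp_radius (ht : 0 < t) (ht' : t ≤ 1) {F : ℝ → ℝ}
    (hF : ∀ x, 0 < x → x ≤ 1 → ContDiffAt ℝ ∞ F x) : ContDiff ℝ ∞ fun ψ => F (radius t ψ) :=
  contDiff_iff_contDiffAt.2 fun ψ =>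
    (hF _ (radius_pos ht ht' ψ) (radius_le_one ht' ψ)).comp ψ (contDiff_radius t).contDiffAt

lemma contDiffAt_heightSq {x : ℝ} (hx : 0 < x) : ContDiffAt ℝ ∞ (heightSq p H t) x :=
  (contDiffAt_const.mul (contDiffAt_id.pow 2)).add
    (contDiffAt_const.div (contDiffAt_id.pow _) (pow_pos hx _).ne')

lemma contDiffAt_angleSpeed (hH : 0 < H) (ht : 0 < t) {x : ℝ} (hx : 0 < x) (hx' : x ≤ 1) :
    ContDiffAt ℝ ∞ (angleSpeed p H t) x := by
  have hc := cofactor_pos p ht.le hx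
  have h1 : ContDiffAt ℝ ∞ (arcSpeed p H t) x :=
    (contDiffAt_const.mul ((contDiffAt_id.pow _).div (contDiff_cofactor p t).contDiffAt
      hc.ne')).sqrt (mul_pos (scaleSq_pos hH ht.le) (div_pos (pow_pos hx _) hc)).ne'
  have h2 : ContDiffAt ℝ ∞ (fun x => √(heightSq p H t x)) x :=
    (contDiffAt_heightSq hx).sqrt (heightSq_pos hH ht.le hx).ne'
  have h3 : ContDiffAt ℝ ∞ (fun x => 1 - scaleSq p H t * x ^ 2) x :=
    contDiffAt_const.sub (contDiffAt_const.mul (contDiffAt_id.pow 2))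
  exact (h1.mul h2).div h3 ((by positivity : 0 < H / (1 + H)).trans_le
    (le_one_sub_scaleSq_mul hH ht.le hx.le hx')).ne'

lemma contDiff_radialSpeed (ht : 0 < t) (ht' : t ≤ 1) : ContDiff ℝ ∞ (radialSpeed p t) := by
  refine (contDiff_const.mul Real.contDiff_sin).mul ?_
  refine contDiff_comp_radius (F := fun x => √(cofactor p t x / x ^ (p + 1))) ht ht'
    fun x hx _ => ?_
  exact ((contDiff_cofactor p t).contDiffAt.div (contDiffAt_id.pow _) (pow_pos hx _).ne').sqrt
    (div_pos (cofactor_pos p ht.le hx) (pow_pos hx _)).ne'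

lemma arcSpeed_mul_radialSpeed (hH : 0 < H) (ht : 0 < t) (ht' : t ≤ 1) (ψ : ℝ) :
    arcSpeed p H t (radius t ψ) * radialSpeed p t ψ =
      √(scaleSq p H t) * ((1 - t) / 2 * Real.sin ψ) := by
  have hx := radius_pos ht ht' ψ
  have hc := cofactor_pos p ht.le hx
  have hxp := pow_pos hx (p + 1)
  have h : arcSpeed p H t (radius t ψ) * √(cofactor p t (radius t ψ) / radius t ψ ^ (p + 1))
      = √(scaleSq p H t) := by
    rw [arcSpeed, ← Real.sqrt_mul (mul_pos (scaleSq_pos hH ht.le) (div_pos hxp hc)).le]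
    congr 1
    field_simp
  rw [radialSpeed, ← h]
  ring

/-- The arc length identity along the phase. -/
lemma phase_identity (hH : 0 < H) (ht : 0 < t) (ht' : t ≤ 1) (ψ : ℝ) :
    (√(scaleSq p H t) * radius t ψ) ^ 2 + √(heightSq p H t (radius t ψ)) ^ 2
      + radialSpeed p t ψ ^ 2 = 1 := by
  have hx := radius_pos ht ht' ψ
  have h := scaleSq_add_heightSq_add (p := p) hH ht.le hx
  have hc := cofactor_pos p ht.le hx
  rw [mul_pow, Real.sq_sqrt (scaleSq_pos hH ht.le).le, Real.sq_sqrt (heightSq_pos hH ht.le hx).le,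
    radialSpeed, mul_pow, Real.sq_sqrt (div_pos hc (pow_pos hx _)).le, ← one_sub_radius_mul]
  exact h

lemma hasDerivAt_phase_radius (hH : 0 < H) (ht : 0 < t) (ht' : t ≤ 1) (ψ : ℝ) :
    HasDerivAt (fun ψ => √(scaleSq p H t) * radius t ψ)
      (arcSpeed p H t (radius t ψ) * radialSpeed p t ψ) ψ :=
  ((hasDerivAt_radius t ψ).const_mul _).congr_deriv
    (arcSpeed_mul_radialSpeed hH ht ht' ψ).symm

lemma hasDerivAt_phase_height (hH : 0 < H) (ht : 0 < t) (ht' : t ≤ 1) (ψ : ℝ) :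
    HasDerivAt (fun ψ => √(heightSq p H t (radius t ψ)))
      (arcSpeed p H t (radius t ψ) * (heightSlope p H t (radius t ψ) * radialSpeed p t ψ)) ψ := by
  have hx := radius_pos ht ht' ψ
  have hh := heightSq_pos (p := p) hH ht.le hx
  have hr := hasDerivAt_radius t ψ
  have h1 : HasDerivAt (fun ψ => heightSq p H t (radius t ψ)) _ ψ :=
    ((hr.pow 2).const_mul (H * scaleSq p H t)).add
      ((hasDerivAt_const ψ (1 - rootSq p t)).div (hr.pow (p + 1)) (pow_pos hx _).ne')
  refine (h1.sqrt hh.ne').congr_deriv ?_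
  have h2 := arcSpeed_mul_radialSpeed (p := p) hH ht ht' ψ
  have h3 : 0 < √(heightSq p H t (radius t ψ)) := Real.sqrt_pos.2 hh
  have h4 : 0 < √(scaleSq p H t) := Real.sqrt_pos.2 (scaleSq_pos hH ht.le)
  rw [mul_left_comm (arcSpeed p H t (radius t ψ)), h2, heightSlope]
  simp only [Nat.add_sub_cancel, Nat.cast_ofNat, Nat.cast_add, Nat.cast_one]
  field_simp
  ring

lemma hasDerivAt_phase_radialSpeed (hH : 0 < H) (ht : 0 < t) (ht' : t < 1) (ψ : ℝ) :
    HasDerivAt (radialSpeed p t) (arcSpeed p H t (radius t ψ) *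
      (-(√(scaleSq p H t) * radius t ψ)
        - heightSlope p H t (radius t ψ) * √(heightSq p H t (radius t ψ)))) ψ := by
  have hv := contDiff_radialSpeed (p := p) ht ht'.le
  have hvd : ∀ ψ, HasDerivAt (radialSpeed p t) (deriv (radialSpeed p t) ψ) ψ := fun ψ =>
    (hv.differentiable (by simp) ψ).hasDerivAt
  have key : deriv (radialSpeed p t) = fun ψ => arcSpeed p H t (radius t ψ) *
      (-(√(scaleSq p H t) * radius t ψ)
        - heightSlope p H t (radius t ψ) * √(heightSq p H t (radius t ψ))) := by
    refine Continuous.ext_on dense_sin_ne_zero (hv.continuous_deriv (by simp)) ?_ ?_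
    · refine (contDiff_comp_radius (F := fun x => arcSpeed p H t x *
        (-(√(scaleSq p H t) * x) - heightSlope p H t x * √(heightSq p H t x))) ht ht'.le
        fun x hx _ => ?_).continuous
      have hc := cofactor_pos p ht.le hx
      have hh := heightSq_pos (p := p) hH ht.le hx
      have h1 : ContDiffAt ℝ ∞ (arcSpeed p H t) x :=
        (contDiffAt_const.mul ((contDiffAt_id.pow _).div (contDiff_cofactor p t).contDiffAt
          hc.ne')).sqrt (mul_pos (scaleSq_pos hH ht.le) (div_pos (pow_pos hx _) hc)).ne'
      have h2 : ContDiffAt ℝ ∞ (fun x => √(heightSq p H t x)) x :=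
        (contDiffAt_heightSq hx).sqrt hh.ne'
      have h3 : ContDiffAt ℝ ∞ (heightSlope p H t) x := by
        refine ContDiffAt.div ((contDiffAt_const.mul (contDiffAt_const.mul contDiffAt_id)).sub
          (contDiffAt_const.div (contDiffAt_id.pow _) (pow_pos hx _).ne'))
          ((contDiffAt_const.mul h2).mul contDiffAt_const) ?_
        exact (mul_pos (mul_pos two_pos (Real.sqrt_pos.2 hh))
          (Real.sqrt_pos.2 (scaleSq_pos hH ht.le))).ne'
      exact h1.mul (((contDiffAt_const.mul contDiffAt_id).neg).sub (h3.mul h2))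
    · intro ψ hψ
      have hv0 : radialSpeed p t ψ ≠ 0 := by
        have hx := radius_pos ht ht'.le ψ
        exact mul_ne_zero (mul_ne_zero (by linarith) hψ) (Real.sqrt_pos.2
          (div_pos (cofactor_pos p ht.le hx) (pow_pos hx _))).ne'
      have h1 := (((hasDerivAt_phase_radius (p := p) hH ht ht'.le ψ).pow 2).add
        ((hasDerivAt_phase_height (p := p) hH ht ht'.le ψ).pow 2)).add ((hvd ψ).pow 2)
      have h2 : HasDerivAt (fun ψ => (√(scaleSq p H t) * radius t ψ) ^ 2 +
          √(heightSq p H t (radius t ψ)) ^ 2 + radialSpeed p t ψ ^ 2) 0 ψ := by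
        rw [funext fun ψ => phase_identity (p := p) hH ht ht'.le ψ]
        exact hasDerivAt_const ψ 1
      have h3 := h1.unique h2
      refine mul_left_cancel₀ hv0 ?_
      simp only [Nat.cast_ofNat, Nat.add_one_sub_one, pow_one] at h3
      linear_combination h3 / 2
  exact (hvd ψ).congr_deriv (congrFun key ψ)

/-- If the increment of the angle over a period is a divisor of the full angle, the phase can be
replaced by the angle. -/
lemma nonempty_profile (hH : 0 < H) (ht : 0 < t) (ht' : t < 1) {k : ℕ} (hk : k ≠ 0)
    (hper : anglePeriod p H t = 2 * Real.pi / k) : Nonempty (Profile (p + 3) H) := by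
  have hI : ContDiff ℝ ∞ fun ψ => angleSpeed p H t (radius t ψ) :=
    contDiff_comp_radius ht ht'.le fun x hx hx' => contDiffAt_angleSpeed hH ht hx hx'
  have hIpos : ∀ ψ, 0 < angleSpeed p H t (radius t ψ) := fun ψ =>
    angleSpeed_pos hH ht.le (radius_pos ht ht'.le ψ) (radius_le_one ht'.le ψ)
  obtain ⟨g, hg, hgs, hgd, hgp⟩ := exists_inverse_primitive Real.two_pi_pos hI hIpos
    (fun ψ => by simp only [periodic_radius t ψ])
  change ∀ θ, g (θ + anglePeriod p H t) = _ at hgp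
  have hsc := scaleSq_pos (p := p) hH ht.le
  have hsc' := Real.sqrt_pos.2 hsc
  have hx : ∀ θ, 0 < radius t (g θ) := fun θ => radius_pos ht ht'.le _
  have hh : ∀ θ, 0 < heightSq p H t (radius t (g θ)) := fun θ => heightSq_pos hH ht.le (hx θ)
  have hD : ∀ θ, 0 < 1 - scaleSq p H t * radius t (g θ) ^ 2 := fun θ =>
    (by positivity : 0 < H / (1 + H)).trans_le
      (le_one_sub_scaleSq_mul hH ht.le (hx θ).le (radius_le_one ht'.le _))
  have hspeed : ∀ θ a, arcSpeed p H t (radius t (g θ)) * a *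
      (angleSpeed p H t (radius t (g θ)))⁻¹ =
      (1 - (√(scaleSq p H t) * radius t (g θ)) ^ 2) / √(heightSq p H t (radius t (g θ))) * a := by
    intro θ a
    have h1 := arcSpeed_pos (p := p) hH ht.le (hx θ)
    have h2 := Real.sqrt_pos.2 (hh θ)
    have h3 := hD θ
    rw [mul_pow, Real.sq_sqrt hsc.le, angleSpeed]
    field_simp
  refine ⟨{
    r := fun θ => √(scaleSq p H t) * radius t (g θ)
    w := fun θ => √(heightSq p H t (radius t (g θ)))
    v := fun θ => radialSpeed p t (g θ)
    κ := fun θ => heightSlope p H t (radius t (g θ))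
    contDiff_r := contDiff_const.mul ((contDiff_radius t).comp hg)
    periodic_r := ?_
    r_pos := fun θ => mul_pos hsc' (hx θ)
    w_pos := fun θ => Real.sqrt_pos.2 (hh θ)
    sq_add_sq := fun θ => phase_identity hH ht ht'.le (g θ)
    hasDerivAt_r := fun θ => ?_
    hasDerivAt_w := fun θ => ?_
    hasDerivAt_v := fun θ => ?_
    mean_eq := fun θ => ?_
    nonconst := ?_ }⟩
  · have h : ∀ (j : ℕ) θ, radius t (g (θ + j * (2 * Real.pi / k))) = radius t (g θ) := by
      intro j
      induction j with
      | zero => simp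
      | succ j ih =>
        intro θ
        rw [Nat.cast_succ, add_mul, one_mul, ← add_assoc, ← hper, hgp, periodic_radius, hper, ih]
    intro θ
    have h2 := h k θ
    rw [mul_div_cancel₀ _ (Nat.cast_ne_zero.2 hk)] at h2
    simp only [h2]
  · exact ((hasDerivAt_phase_radius hH ht ht'.le (g θ)).comp θ (hgd θ)).congr_deriv (hspeed θ _)
  · exact ((hasDerivAt_phase_height hH ht ht'.le (g θ)).comp θ (hgd θ)).congr_deriv (hspeed θ _)
  · exact ((hasDerivAt_phase_radialSpeed hH ht ht' (g θ)).comp θ (hgd θ)).congr_deriv (hspeed θ _)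
  · have h1 := Real.sqrt_pos.2 (hh θ)
    have h2 := hx θ
    have h3 : 2 * √(heightSq p H t (radius t (g θ))) * heightSlope p H t (radius t (g θ)) *
        (√(scaleSq p H t) * radius t (g θ)) = (2 * (H * scaleSq p H t * radius t (g θ))
          - (p + 1) * (1 - rootSq p t) / radius t (g θ) ^ (p + 2)) * radius t (g θ) := by
      rw [heightSlope]
      field_simp
    rw [h3, Real.sq_sqrt (hh θ).le, mul_pow, Real.sq_sqrt hsc.le, heightSq]
    push_cast
    field_simp
    ring
  · obtain ⟨θ₁, h1⟩ := hgs 0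
    obtain ⟨θ₂, h2⟩ := hgs Real.pi
    refine ⟨θ₁, θ₂, ?_⟩
    have hr1 : radius t 0 = t := by
      simp [radius]
      ring
    have hr2 : radius t Real.pi = 1 := by
      simp [radius]
      ring
    have hkey : ∀ x, 0 < x → H - (√(heightSq p H t x) / (√(scaleSq p H t) * x)) ^ 2 =
        -((1 - rootSq p t) / scaleSq p H t) / x ^ (p + 3) := fun x hx => by
      rw [div_pow, mul_pow, Real.sq_sqrt (heightSq_pos hH ht.le hx).le, Real.sq_sqrt hsc.le,
        heightSq]
      field_simp
      ring
    simp only [h1, h2, hr1, hr2]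
    rw [hkey t ht, hkey 1 one_pos, one_pow, div_one, div_pow, Ne, div_eq_iff (by positivity)]
    have hA := rootSq_lt_one p ht
    have hC : 0 < (-((1 - rootSq p t) / scaleSq p H t)) ^ 2 := by
      rw [neg_sq]
      exact pow_pos (div_pos (by linarith) hsc) 2
    have hlt : (t ^ (p + 3)) ^ 2 < 1 :=
      pow_lt_one₀ (by positivity) (pow_lt_one₀ ht.le ht' (by omega)) two_ne_zero
    nlinarith

/-- There is a profile with `k` periods whenever `2π/k` lies strictly between the limits of the
period function. -/
lemma nonempty_profile_of_between (hH : 0 < H) {k : ℕ} (hk : k ≠ 0)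
    (h : (2 * Real.arctan (1 / √H) < 2 * Real.pi / k ∧
        2 * Real.pi / k < 2 * Real.pi / √((p + 3) * H + 2)) ∨
      (2 * Real.pi / √((p + 3) * H + 2) < 2 * Real.pi / k ∧
        2 * Real.pi / k < 2 * Real.arctan (1 / √H))) : Nonempty (Profile (p + 3) H) := by
  rw [← anglePeriod_zero (p := p) hH, ← anglePeriod_one (p := p) hH] at h
  have hc := continuousOn_anglePeriod (p := p) hH
  obtain ⟨t, ht, hper⟩ : 2 * Real.pi / k ∈ anglePeriod p H '' Set.Ioo 0 1 := by
    rcases h with h | h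
    · exact intermediate_value_Ioo zero_le_one hc h
    · exact intermediate_value_Ioo' zero_le_one hc h
  exact nonempty_profile hH ht.1 ht.2 hk hper

end Phase

lemma cot_sq_add_one {x : ℝ} (hx : Real.sin x ≠ 0) : Real.cot x ^ 2 + 1 = 1 / Real.sin x ^ 2 := by
  rw [Real.cot_eq_cos_div_sin]
  field_simp
  exact Real.cos_sq_add_sin_sq x

lemma cot_sq_arctan {H : ℝ} (hH : 0 < H) : Real.cot (Real.arctan (1 / √H)) ^ 2 = H := by
  rw [← Real.tan_inv_eq_cot, Real.tan_arctan, one_div, inv_inv, Real.sq_sqrt hH.le]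

lemma cot_sq_lt_cot_sq {x y : ℝ} (hx : 0 < x) (hx' : x ≤ Real.pi / 2) (hy : 0 < y)
    (hy' : y ≤ Real.pi / 2) : Real.cot y ^ 2 < Real.cot x ^ 2 ↔ x < y := by
  have hpi := Real.pi_pos
  have hsx : 0 < Real.sin x := Real.sin_pos_of_pos_of_lt_pi hx (by linarith)
  have hsy : 0 < Real.sin y := Real.sin_pos_of_pos_of_lt_pi hy (by linarith)
  rw [← add_lt_add_iff_right 1, cot_sq_add_one hsx.ne', cot_sq_add_one hsy.ne',
    one_div_lt_one_div (by positivity) (by positivity), sq_lt_sq₀ hsx.le hsy.le]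
  exact Real.strictMonoOn_sin.lt_iff_lt ⟨by linarith, hx'⟩ ⟨by linarith, hy'⟩

lemma nonempty_profile_of_lt {n k : ℕ} (hn : 3 ≤ n) (hk : 2 ≤ k) {H : ℝ} (hH : 0 < H)
    (hlow : min (Real.cot (Real.pi / (k : ℝ)) ^ 2) (((k : ℝ) ^ 2 - 2) / (n : ℝ)) < H)
    (hupp : H < max (Real.cot (Real.pi / (k : ℝ)) ^ 2) (((k : ℝ) ^ 2 - 2) / (n : ℝ))) :
    Nonempty (Profile n H) := by
  obtain ⟨p, rfl⟩ : ∃ p, n = p + 3 := ⟨n - 3, by omega⟩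
  have hk2 : (2 : ℝ) ≤ k := by exact_mod_cast hk
  have hk0 : (0 : ℝ) < k := by linarith
  have hpi := Real.pi_pos
  push_cast at hlow hupp
  have hp0 : (0 : ℝ) < p + 3 := by positivity
  have hN : 0 < ((p : ℝ) + 3) * H + 2 := by positivity
  set a := Real.arctan (1 / √H)
  have ha : 0 < a := Real.arctan_pos.2 (one_div_pos.2 (Real.sqrt_pos.2 hH))
  have ha' : a < Real.pi / 2 := Real.arctan_lt_pi_div_two _
  have hca : Real.cot a ^ 2 = H := cot_sq_arctan hH
  have hb : 0 < Real.pi / k := by positivity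
  have hb' : Real.pi / k ≤ Real.pi / 2 := div_le_div_of_nonneg_left hpi.le two_pos hk2
  have e1 : Real.cot (Real.pi / k) ^ 2 < H ↔ 2 * a < 2 * Real.pi / k := by
    rw [← hca, cot_sq_lt_cot_sq ha ha'.le hb hb', mul_div_assoc, mul_lt_mul_iff_right₀ two_pos]
  have e2 : H < Real.cot (Real.pi / k) ^ 2 ↔ 2 * Real.pi / k < 2 * a := by
    rw [← hca, cot_sq_lt_cot_sq hb hb' ha ha'.le, mul_div_assoc, mul_lt_mul_iff_right₀ two_pos]
  have e3 : H < ((k : ℝ) ^ 2 - 2) / (p + 3) ↔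
      2 * Real.pi / k < 2 * Real.pi / √((p + 3) * H + 2) := by
    rw [div_lt_div_iff_of_pos_left Real.two_pi_pos hk0 (Real.sqrt_pos.2 hN),
      Real.sqrt_lt' hk0, lt_div_iff₀ hp0]
    constructor <;> intro h <;> linarith
  have e4 : ((k : ℝ) ^ 2 - 2) / (p + 3) < H ↔
      2 * Real.pi / √((p + 3) * H + 2) < 2 * Real.pi / k := by
    rw [div_lt_div_iff_of_pos_left Real.two_pi_pos (Real.sqrt_pos.2 hN) hk0,
      Real.lt_sqrt hk0.le, div_lt_iff₀ hp0]
    constructor <;> intro h <;> linarith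
  refine nonempty_profile_of_between hH (k := k) (by omega) ?_
  rcases min_lt_iff.1 hlow with h1 | h1 <;> rcases lt_max_iff.1 hupp with h2 | h2
  · exact absurd h1 h2.not_gt
  · exact Or.inl ⟨e1.1 h1, e3.1 h2⟩
  · exact Or.inr ⟨e4.1 h1, e2.1 h2⟩
  · exact absurd h1 h2.not_gt

end SphereHypersurface

theorem proposition5p2 (n k : ℕ) (hn : 3 ≤ n) (hk : 2 ≤ k) (R H₂ : ℝ)
    (hR : H₂ = (R - (n : ℝ) * ((n : ℝ) - 1)) / ((n : ℝ) * ((n : ℝ) - 1)))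
    (hlow : min (Real.cot (Real.pi / (k : ℝ)) ^ 2) (((k : ℝ) ^ 2 - 2) / (n : ℝ)) < H₂)
    (hupp : H₂ < max (Real.cot (Real.pi / (k : ℝ)) ^ 2) (((k : ℝ) ^ 2 - 2) / (n : ℝ))) :
    0 < H₂ ∧ (n : ℝ) * ((n : ℝ) - 1) < R ∧
      ∃ M : Set (SphereHypersurface.E (n + 2)),
        SphereHypersurface.IsCompactEmbeddedHypersurface n M ∧
        SphereHypersurface.HasConstantSecondMeanCurvature n M H₂ ∧
        SphereHypersurface.HasConstantScalarCurvature n M R ∧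
        SphereHypersurface.IsNontrivial n M := by
  have hn3 : (3 : ℝ) ≤ n := by exact_mod_cast hn
  have hk2 : (2 : ℝ) ≤ k := by exact_mod_cast hk
  have hnn : 0 < (n : ℝ) * ((n : ℝ) - 1) := mul_pos (by linarith) (by linarith)
  have hH : 0 < H₂ := by
    refine lt_of_le_of_lt (le_min (sq_nonneg _) (div_nonneg ?_ (by linarith))) hlow
    nlinarith
  have hR' : R = (n : ℝ) * ((n : ℝ) - 1) * (1 + H₂) := by
    rw [eq_div_iff hnn.ne'] at hR
    linarith
  obtain ⟨P⟩ := SphereHypersurface.nonempty_profile_of_lt hn hk hH hlow hupp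
  refine ⟨hH, by nlinarith, P.surface, P.isCompactEmbeddedHypersurface (by omega),
    P.hasConstantSecondMeanCurvature (by omega), ?_, P.isNontrivial hn⟩
  rw [hR']
  exact P.hasConstantScalarCurvature
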